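/- For $\theta\in\mathbb R$ let $\mathbb C_\theta=\{s\in\mathbb C:\Re s>\theta\}$ and $\mathbb C_+=\mathbb C_0$. Let $h:(0,\infty)\to[0,\infty)$ be integrable with $\int_0^\infty h=1$ and $\int_0^\varepsilon h>0$ for every $\varepsilon>0$, and let $d\mu=h\,d\sigma$. Put $w_h(n)=\int_0^\infty n^{-2\sigma}h(\sigma)\,d\sigma$ and $\beta_h(\sigma)=\int_0^\sigma(\sigma-u)h(u)\,du$ for $\sigma>0$. Let $\mathcal A^2_\mu$ be the Hilbert space of Dirichlet series $f(s)=\sum_{n\ge1}a_nn^{-s}$ with $\|f\|^2=\sum_{n\ge1}|a_n|^2w_h(n)<\infty$, which are analytic functions on $\mathbb C_{1/2}$. Let $c_0\ge1$ be an integer and let $\Phi:\mathbb C_{1/2}\to\mathbb C_{1/2}$ be a $c_0$-symbol: $\Phi$ is analytic, $\Phi(s)=c_0s+\varphi(s)$ where $\varphi$ is represented by a convergent Dirichlet series in some half-plane, and $C_\Phi f=f\circ\Phi$ is bounded on $\mathcal A^2_\mu$. We write $\Phi$ and $\varphi$ also for the analytic continuations of these functions to $\mathbb C_+$. For $s\in\mathbb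 C_+$ let $$N_{\beta_h,\Phi}(s)=\sum_{a\in\mathbb C_+,\ \Phi(a)=s}\beta_h(\Re a)$$ (distinct solutions $a$, the empty sum being $0$). Assume that $\beta_h$ satisfies condition $(\kappa)$: with $G(\sigma)=\beta_h(\sigma)/\sigma$, $$\lim_{\eta\to0^+}\ \limsup_{\sigma\to0^+}\frac{G(\eta\sigma)}{G(\sigma)}=0 .$$ Assume moreover that $\Re s/\Re\Phi(s)\to0$ as $\Re s\to0^+$ (uniformly in $\Im s$). Then $N_{\beta_h,\Phi}$ is finite on $\mathbb C_+$ and $$N_{\beta_h,\Phi}(s)=o(\beta_h(\Re s))\qquad\text{as }\Re s\to0^+\ \text{(uniformly in }\Im s).$$ Hence, if in addition $\operatorname{Im}\varphi$ is bounded on $\mathbb C_+$, then $C_\Phi$ is compact on $\mathcal A^2_\mu$. -/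

import Mathlib

open Filter Topology Set Asymptotics
open scoped ENNReal

namespace DirichletBergman

/-- The open half-plane `Re s > θ`. -/
def halfPlane (θ : ℝ) : Set ℂ := {s : ℂ | θ < s.re}

/-- `h` is the density of a probability measure `dμ = h dσ` on `(0, ∞)` whose support
contains `0` (every interval `(0, ε)` has positive mass). -/
structure IsDensity (h : ℝ → ℝ) : Prop where
  nonneg : ∀ σ : ℝ, 0 < σ → 0 ≤ h σ
  integrable : MeasureTheory.IntegrableOn h (Ioi 0)
  integral_eq_one : ∫ σ in Ioi (0 : ℝ), h σ = 1
  zero_mem_support : ∀ ε : ℝ, 0 < ε → 0 < ∫ σ in Ioo 0 ε, h σ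

/-- `w_h(n) = ∫₀^∞ n^{-2σ} h(σ) dσ`, the square of the norm of `n^{-s}`. -/
noncomputable def weight (h : ℝ → ℝ) (n : ℕ+) : ℝ :=
  ∫ σ in Ioi (0 : ℝ), (n : ℝ) ^ (-2 * σ) * h σ

/-- `β_h(σ) = ∫₀^σ (σ - u) h(u) du`. -/
noncomputable def beta (h : ℝ → ℝ) (σ : ℝ) : ℝ :=
  ∫ u in (0 : ℝ)..σ, (σ - u) * h u

/-- The Hilbert space `𝒜²_μ`, `dμ = h dσ`, of Dirichlet series `∑ aₙ n^{-s}` with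
`‖f‖² = ∑ |aₙ|² w_h(n) < ∞`; this is the completion of the Dirichlet polynomials for
`‖P‖² = ∫ ∑ |aₙ|² n^{-2σ} dμ(σ)`. The element with coefficients `aₙ` is given by its
coordinates `aₙ √w_h(n)` in the orthonormal basis `n^{-s} / √w_h(n)`. -/
abbrev Bergman (_h : ℝ → ℝ) : Type := lp (fun _ : ℕ+ => ℂ) 2

/-- The `n`-th Dirichlet coefficient `aₙ` of an element of `𝒜²_μ`. -/
noncomputable def coeff (h : ℝ → ℝ) (f : Bergman h) (n : ℕ+) : ℂ :=
  f n / (Real.sqrt (weight h n) : ℂ)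

/-- The value `f(s) = ∑ aₙ n^{-s}`; the series converges absolutely for `Re s > 1/2`. -/
noncomputable def eval (h : ℝ → ℝ) (f : Bergman h) (s : ℂ) : ℂ :=
  ∑' n : ℕ+, coeff h f n * (n : ℂ) ^ (-s)

/-- The bounded operator `T` on `𝒜²_μ` is the composition operator `f ↦ f ∘ Φ`, as functions
on the half-plane `Re s > 1/2`. -/
def IsCompositionOperator (h : ℝ → ℝ) (Φ : ℂ → ℂ) (T : Bergman h →L[ℂ] Bergman h) : Prop :=
  ∀ f : Bergman h, ∀ s ∈ halfPlane (1 / 2), eval h (T f) s = eval h f (Φ s)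

/-- `C_Φ` is a bounded operator on `𝒜²_μ`. -/
def CompositionBounded (h : ℝ → ℝ) (Φ : ℂ → ℂ) : Prop :=
  ∃ T : Bergman h →L[ℂ] Bergman h, IsCompositionOperator h Φ T

/-- `C_Φ` is a compact operator on `𝒜²_μ`. -/
def CompositionCompact (h : ℝ → ℝ) (Φ : ℂ → ℂ) : Prop :=
  ∃ T : Bergman h →L[ℂ] Bergman h, IsCompositionOperator h Φ T ∧ IsCompactOperator T

/-- The class `𝒟`: in some half-plane, `φ` is the sum of a convergent Dirichlet series. -/
def InClassD (φ : ℂ → ℂ) : Prop :=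
  ∃ (a : ℕ → ℂ) (θ : ℝ), ∀ s ∈ halfPlane θ,
    Tendsto (fun N : ℕ => ∑ n ∈ Finset.Icc 1 N, a n * (n : ℂ) ^ (-s)) atTop (𝓝 (φ s))

/-- `Φ` is a `c₀`-symbol for `𝒜²_μ`: an analytic self-map of `Re s > 1/2` of the form
`Φ(s) = c₀ s + φ(s)` with `φ ∈ 𝒟`, such that `C_Φ` is bounded on `𝒜²_μ`. -/
structure IsSymbol (h : ℝ → ℝ) (c₀ : ℕ) (Φ : ℂ → ℂ) : Prop where
  analytic : DifferentiableOn ℂ Φ (halfPlane (1 / 2))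
  mapsTo : MapsTo Φ (halfPlane (1 / 2)) (halfPlane (1 / 2))
  inClassD : InClassD (fun s => Φ s - c₀ * s)
  bounded : CompositionBounded h Φ

/-- The generalized Nevanlinna counting function
`N_{β,Φ}(s) = ∑_{Re a > 0, Φ(a) = s} β(Re a)`, with values in `[0, ∞]`; the sum is empty, hence
zero, when `s` is not a value of `Φ` on `Re a > 0`. -/
noncomputable def nevanlinna (β : ℝ → ℝ) (Φ : ℂ → ℂ) (s : ℂ) : ℝ≥0∞ :=
  ∑' a : {a : ℂ // a ∈ halfPlane 0 ∧ Φ a = s}, ENNReal.ofReal (β (a : ℂ).re)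

/-- Condition `(κ)`: with `G(σ) = β(σ)/σ`,
`lim_{η → 0⁺} limsup_{σ → 0⁺} G(ησ)/G(σ) = 0`. -/
def Kappa (β : ℝ → ℝ) : Prop :=
  Tendsto
    (fun η : ℝ => limsup
      (fun σ : ℝ => ENNReal.ofReal ((β (η * σ) / (η * σ)) / (β σ / σ))) (𝓝[>] (0 : ℝ)))
    (𝓝[>] (0 : ℝ)) (𝓝 0)

/-- The filter `Re s → 0⁺` on the right half-plane, with no restriction on `Im s`. -/
def reToZero : Filter ℂ := comap Complex.re (𝓝[>] (0 : ℝ))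

end DirichletBergman

/-! Boundedness of `C_Φ` forces `Re Φ ≥ 0` on `Re s > 0` (`IsCompositionOperator.re_nonneg`). The
powers of `2^{-Φ}` are images of monomials of norm at most `1`, so their coefficients are `O(n^e)`
uniformly in the power, for every `e > 0`. Restricted to smooth integers, such series converge on
all of `Re s > 0`, and uniform boundedness of all powers gives modulus at most `1`; a limit then
gives `|2^{-Φ}| ≤ 1`. Since `Φ(x)/x → c₀`, comparison with Blaschke products gives the Littlewood
inequality `∑ Re a ≤ Re w / c₀` over the preimages of `w` (`sum_re_le_of_mapsTo`); a single preimage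
yields `Re Φ(s) ≥ c₀ Re s`.

Counting function: `G = β/σ` is nondecreasing, so if all preimages of `s` satisfy `Re a ≤ r`, then
`N(s) ≤ G(r) Re s / c₀` (`nevanlinna_le`). Taking `r = Re s` gives finiteness. For small `Re s` the
hypothesis on `Re s / Re Φ(s)` permits `r = η Re s`, and `(κ)` bounds `G(η Re s)` by `ε G(Re s)`.

Compactness rests on a subordination principle (`sum_norm_sq_le_of_subordinate`): if `Re Φ ≥ μ` on
`Re s ≥ x`, the mean square of `f ∘ Φ` on `Re s = x` is at most that of `f` on `Re w = μ`. With `μ =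
Kσ` for `σ ≤ δ` and `μ = σ` otherwise, integration against `h` gives `‖C_Φ f‖² ≤ ∑ |aₙ|² (∫₀^∞
n^{-2Kσ} h + ∫_δ^∞ n^{-2σ} h)`. By `(κ)` at the scale `σ = 1 / log n`, the bracket is at most `ε²
w_h(n)` for large `n`. Thus `C_Φ` is small on high frequencies, hence a norm limit of finite-rank
operators. -/

namespace DirichletBergman

/-! ### Blaschke products and the Littlewood inequality on the half-plane -/

open ComplexConjugate in
/-- The Schwarz lemma on the right half-plane. -/
theorem norm_mul_norm_add_conj_le {g : ℂ → ℂ} (hg : DifferentiableOn ℂ g (halfPlane 0))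
    (hb : ∀ s ∈ halfPlane 0, ‖g s‖ ≤ 1) {a s : ℂ} (ha : a ∈ halfPlane 0) (h0 : g a = 0)
    (hs : s ∈ halfPlane 0) : ‖g s‖ * ‖s + conj a‖ ≤ ‖s - a‖ := by
  have ha' : 0 < a.re := ha
  have hs' : 0 < s.re := hs
  have hden : s + conj a ≠ 0 := fun h => by
    have := congrArg Complex.re h
    simp at this
    linarith
  -- Cayley map of the disc onto the half-plane with `c 0 = a`, inverse to `s ↦ (s - a) / (s + conj
  -- a)`.
  set c : ℂ → ℂ := fun z => (a + conj a * z) / (1 - z) with hc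
  have hne : ∀ z ∈ Metric.ball (0 : ℂ) 1, 1 - z ≠ 0 := fun z hz h => by
    have : z = 1 := (sub_eq_zero.1 h).symm
    simp [this] at hz
  have hcm : MapsTo c (Metric.ball 0 1) (halfPlane 0) := by
    intro z hz
    have h1 := hne z hz
    have hn : 0 < Complex.normSq (1 - z) := Complex.normSq_pos.2 h1
    have hz1 : Complex.normSq z < 1 := by
      rw [Complex.normSq_eq_norm_sq]
      have : ‖z‖ < 1 := by simpa using hz
      nlinarith [norm_nonneg z]
    show 0 < (c z).re
    rw [hc]
    simp only [Complex.div_re]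
    rw [← add_div]
    refine div_pos ?_ hn
    rw [Complex.normSq_apply] at hz1
    simp
    nlinarith
  have hcd : DifferentiableOn ℂ c (Metric.ball 0 1) := by
    intro z hz
    have := hne z hz
    exact DifferentiableAt.differentiableWithinAt (by fun_prop (disch := assumption))
  set z : ℂ := (s - a) / (s + conj a) with hz
  have hz1 : ‖z‖ < 1 := by
    rw [hz, norm_div, div_lt_one (norm_pos_iff.2 hden)]
    refine lt_of_pow_lt_pow_left₀ 2 (norm_nonneg _) ?_
    rw [← Complex.normSq_eq_norm_sq, ← Complex.normSq_eq_norm_sq, Complex.normSq_apply,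
      Complex.normSq_apply]
    simp
    nlinarith [mul_pos ha' hs']
  have hcz : c z = s := by
    have h1 : 1 - z ≠ 0 := hne z (by simpa using hz1)
    rw [hc]
    simp only
    rw [div_eq_iff h1, hz]
    field_simp
    ring
  have key := Complex.norm_le_norm_of_mapsTo_ball (f := g ∘ c) (R := 1)
    (hg.comp hcd hcm) (fun z hz => by simpa using hb _ (hcm hz)) (by simp [hc, h0]) hz1
  rw [Function.comp_apply, hcz, hz, norm_div, le_div_iff₀ (norm_pos_iff.2 hden)] at key
  exact key

theorem isOpen_halfPlane (θ : ℝ) : IsOpen (halfPlane θ) :=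
  isOpen_lt continuous_const Complex.continuous_re

open ComplexConjugate in
/-- A function bounded by `1` on the right half-plane is dominated by the finite Blaschke product
of its zeros. -/
theorem norm_mul_prod_le_prod (S : Finset ℂ) : ∀ {g : ℂ → ℂ},
    DifferentiableOn ℂ g (halfPlane 0) → (∀ s ∈ halfPlane 0, ‖g s‖ ≤ 1) →
    (∀ a ∈ S, a ∈ halfPlane 0 ∧ g a = 0) → ∀ s ∈ halfPlane 0,
    ‖g s‖ * ∏ a ∈ S, ‖s + conj a‖ ≤ ∏ a ∈ S, ‖s - a‖ := by
  classical
  induction S using Finset.induction_on with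
  | empty => intro g _ hb _ s hs; simpa using hb s hs
  | insert a S haS ih =>
    intro g hg hb hS s hs
    obtain ⟨ha, h0⟩ := hS a (Finset.mem_insert_self _ _)
    have hnhds : halfPlane 0 ∈ 𝓝 a := (isOpen_halfPlane 0).mem_nhds ha
    -- This is `g` divided by its Blaschke factor at `a`. The Schwarz lemma bounds it by `1` off
    -- `a`, continuity at `a`.
    set g₁ : ℂ → ℂ := fun s => dslope g a s * (s + conj a) with hg₁
    have hd : DifferentiableOn ℂ g₁ (halfPlane 0) :=
      ((Complex.differentiableOn_dslope hnhds).2 hg).mul (by fun_prop)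
    have hfac : ∀ s, g s = dslope g a s * (s - a) := by
      intro s
      have := sub_smul_dslope g a s
      rw [h0, sub_zero, smul_eq_mul] at this
      rw [← this, mul_comm]
    have hne : ∀ s ∈ halfPlane 0, s ≠ a → ‖g₁ s‖ ≤ 1 := by
      intro s hs hsa
      have h1 := norm_mul_norm_add_conj_le hg hb ha h0 hs
      have h2 : 0 < ‖s - a‖ := norm_pos_iff.2 (sub_ne_zero.2 hsa)
      rw [hfac s, norm_mul] at h1
      rw [hg₁, norm_mul]
      nlinarith
    have hb₁ : ∀ s ∈ halfPlane 0, ‖g₁ s‖ ≤ 1 := by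
      intro s hs
      rcases eq_or_ne s a with rfl | hsa
      · have hc : Tendsto (fun z => ‖g₁ z‖) (𝓝[≠] s) (𝓝 ‖g₁ s‖) :=
          ((hd.continuousOn.continuousAt hnhds).norm.tendsto).mono_left nhdsWithin_le_nhds
        refine le_of_tendsto hc ?_
        filter_upwards [nhdsWithin_le_nhds hnhds, self_mem_nhdsWithin] with z hz hz'
        exact hne z hz hz'
      · exact hne s hs hsa
    have hS₁ : ∀ b ∈ S, b ∈ halfPlane 0 ∧ g₁ b = 0 := by
      intro b hb
      obtain ⟨h1, h2⟩ := hS b (Finset.mem_insert_of_mem hb)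
      refine ⟨h1, ?_⟩
      have hba : b - a ≠ 0 := sub_ne_zero.2 fun h => haS (h ▸ hb)
      have := hfac b
      rw [h2] at this
      rw [hg₁]
      simp only
      rw [(mul_eq_zero.1 this.symm).resolve_right hba, zero_mul]
    have := ih hd hb₁ hS₁ s hs
    rw [Finset.prod_insert haS, Finset.prod_insert haS, hfac s, norm_mul]
    rw [hg₁, norm_mul] at this
    calc _ = ‖s - a‖ * (‖dslope g a s‖ * ‖s + conj a‖ * ∏ a ∈ S, ‖s + conj a‖) := by ring
      _ ≤ _ := by gcongr

/-- First-order defects add up under products, since `1 - pq = (1 - p) + p(1 - q)`. -/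
theorem tendsto_mul_one_sub_prod {ι : Type*} (S : Finset ι) {p : ι → ℝ → ℝ} {l : ι → ℝ}
    (hp : ∀ i ∈ S, Tendsto (p i) atTop (𝓝 1))
    (hl : ∀ i ∈ S, Tendsto (fun x => x * (1 - p i x)) atTop (𝓝 (l i))) :
    Tendsto (fun x => ∏ i ∈ S, p i x) atTop (𝓝 1) ∧
    Tendsto (fun x => x * (1 - ∏ i ∈ S, p i x)) atTop (𝓝 (∑ i ∈ S, l i)) := by
  classical
  induction S using Finset.induction_on with
  | empty => simp
  | insert a S haS ih =>
    obtain ⟨h1, h2⟩ := ih (fun i hi => hp i (Finset.mem_insert_of_mem hi))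
      (fun i hi => hl i (Finset.mem_insert_of_mem hi))
    have ha := hp a (Finset.mem_insert_self _ _)
    have hla := hl a (Finset.mem_insert_self _ _)
    simp only [Finset.prod_insert haS, Finset.sum_insert haS]
    refine ⟨by simpa using ha.mul h1, ?_⟩
    have := hla.add (ha.mul h2)
    rw [one_mul] at this
    exact this.congr fun x => by ring

-- Makes the defect `1 - |(z - w)/(z + conj w)|²` of a Blaschke factor explicit.
open ComplexConjugate in
theorem norm_sub_sq_add (z w : ℂ) : ‖z - w‖ ^ 2 + 4 * z.re * w.re = ‖z + conj w‖ ^ 2 := by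
  rw [← Complex.normSq_eq_norm_sq, ← Complex.normSq_eq_norm_sq, Complex.normSq_apply,
    Complex.normSq_apply]
  simp
  ring

-- The first-order defect at infinity of the Blaschke factor of `Ψ` at `w`; needed for `Ψ` itself
-- and for the identity map.
open ComplexConjugate in
theorem tendsto_mul_div_norm_sq {Ψ : ℝ → ℂ} {c : ℝ} (hc : 0 < c)
    (hlim : Tendsto (fun x : ℝ => Ψ x / x) atTop (𝓝 c)) (w : ℂ) :
    Tendsto (fun x : ℝ => x * (4 * (Ψ x).re * w.re / ‖Ψ x + conj w‖ ^ 2)) atTop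
      (𝓝 (4 * w.re / c)) := by
  have h1 : Tendsto (fun x : ℝ => (Ψ x / x).re) atTop (𝓝 c) := by
    exact (Complex.continuous_re.tendsto _).comp hlim
  have h2 : Tendsto (fun x : ℝ => conj w / (x : ℂ)) atTop (𝓝 0) := by
    have : Tendsto (fun x : ℝ => conj w * ((x⁻¹ : ℝ) : ℂ)) atTop (𝓝 (conj w * ((0 : ℝ) : ℂ))) :=
      ((Complex.continuous_ofReal.tendsto 0).comp tendsto_inv_atTop_zero).const_mul _
    simpa [div_eq_mul_inv] using this
  have h3 : Tendsto (fun x : ℝ => ‖Ψ x / x + conj w / x‖ ^ 2) atTop (𝓝 (c ^ 2)) := by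
    have := ((hlim.add h2).norm).pow 2
    simpa [abs_of_pos hc] using this
  have h4 := ((h1.const_mul (4 * w.re)).div h3 (by positivity))
  have h5 : 4 * w.re * c / c ^ 2 = 4 * w.re / c := by field_simp
  rw [h5] at h4
  refine h4.congr' ?_
  filter_upwards [eventually_gt_atTop (0 : ℝ)] with x hx
  simp only [Pi.div_apply]
  rw [← add_div, norm_div, Complex.div_ofReal_re, Complex.norm_real, Real.norm_of_nonneg hx.le]
  rcases eq_or_ne (‖Ψ x + conj w‖) 0 with h | h
  · simp [h]
  · field_simp

open ComplexConjugate in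
/-- The Littlewood inequality for maps of the right half-plane with angular derivative `c` at
infinity. -/
theorem sum_re_le_of_mapsTo {Ψ : ℂ → ℂ} (hΨ : DifferentiableOn ℂ Ψ (halfPlane 0))
    (hre : ∀ s ∈ halfPlane 0, 0 ≤ (Ψ s).re) {c : ℝ} (hc : 0 < c)
    (hlim : Tendsto (fun x : ℝ => Ψ x / x) atTop (𝓝 c)) {w : ℂ} (hw : 0 < w.re) (S : Finset ℂ)
    (hS : ∀ a ∈ S, a ∈ halfPlane 0 ∧ Ψ a = w) : ∑ a ∈ S, a.re ≤ w.re / c := by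
  have hden : ∀ s ∈ halfPlane 0, Ψ s + conj w ≠ 0 := fun s hs h => by
    have := congrArg Complex.re h
    simp at this
    linarith [hre s hs]
  set g : ℂ → ℂ := fun s => (Ψ s - w) / (Ψ s + conj w) with hg
  have hgd : DifferentiableOn ℂ g (halfPlane 0) :=
    (hΨ.sub_const _).div (hΨ.add_const _) hden
  have hsq : ∀ s ∈ halfPlane 0, ‖g s‖ ^ 2 = 1 - 4 * (Ψ s).re * w.re / ‖Ψ s + conj w‖ ^ 2 := by
    intro s hs
    have : 0 < ‖Ψ s + conj w‖ := norm_pos_iff.2 (hden s hs)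
    rw [hg, norm_div, div_pow, eq_sub_iff_add_eq, ← add_div, norm_sub_sq_add, div_self]
    positivity
  have hb : ∀ s ∈ halfPlane 0, ‖g s‖ ≤ 1 := by
    intro s hs
    have h1 := hre s hs
    have : 0 ≤ 4 * (Ψ s).re * w.re / ‖Ψ s + conj w‖ ^ 2 := by positivity
    have h2 := hsq s hs
    refine (sq_le_one_iff₀ (norm_nonneg _)).1 (by linarith)
  have key := norm_mul_prod_le_prod S hgd hb (fun a ha => ⟨(hS a ha).1, by simp [hg, (hS a ha).2]⟩)
  set p : ℂ → ℝ → ℝ := fun a x => 1 - 4 * ((x : ℂ)).re * a.re / ‖(x : ℂ) + conj a‖ ^ 2 with hp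
  have hl : ∀ a ∈ S, Tendsto (fun x => x * (1 - p a x)) atTop (𝓝 (4 * a.re)) := by
    intro a _
    have h1 : Tendsto (fun x : ℝ => ((x : ℂ)) / x) atTop (𝓝 ((1 : ℝ) : ℂ)) := by
      refine tendsto_const_nhds.congr' ?_
      filter_upwards [eventually_gt_atTop (0 : ℝ)] with x hx
      rw [div_self (by exact_mod_cast hx.ne')]
      simp
    have := tendsto_mul_div_norm_sq (Ψ := fun x => (x : ℂ)) one_pos h1 a
    rw [div_one] at this
    simpa [hp] using this
  have hp1 : ∀ a ∈ S, Tendsto (p a) atTop (𝓝 1) := by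
    intro a ha
    have h1 := (hl a ha).mul tendsto_inv_atTop_zero
    rw [mul_zero] at h1
    have h2 := h1.const_sub 1
    rw [sub_zero] at h2
    refine h2.congr' ?_
    filter_upwards [eventually_gt_atTop (0 : ℝ)] with x hx
    field_simp
    ring
  have hL := (tendsto_mul_one_sub_prod S hp1 hl).2
  have hR := tendsto_mul_div_norm_sq hc hlim w
  -- Both sides of `|g(x)|² ≤ ∏ |b_a(x)|²` tend to `1` as `x → +∞`; comparing their defects
  -- multiplied by `x` gives the inequality.
  have hle : ∑ a ∈ S, 4 * a.re ≤ 4 * w.re / c := by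
    refine le_of_tendsto_of_tendsto hL hR ?_
    filter_upwards [eventually_gt_atTop (0 : ℝ)] with x hx
    have hx' : (x : ℂ) ∈ halfPlane 0 := by simpa [halfPlane] using hx
    refine mul_le_mul_of_nonneg_left ?_ hx.le
    have h1 := key x hx'
    have hpos : ∀ a ∈ S, 0 < ‖(x : ℂ) + conj a‖ := by
      intro a ha
      refine norm_pos_iff.2 fun h => ?_
      have h2 := congrArg Complex.re h
      have h3 : 0 < a.re := (hS a ha).1
      simp at h2
      linarith
    have h2 : ‖g x‖ ^ 2 ≤ ∏ a ∈ S, p a x := by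
      have h3 : ∏ a ∈ S, p a x =
          (∏ a ∈ S, ‖(x : ℂ) - a‖) ^ 2 / (∏ a ∈ S, ‖(x : ℂ) + conj a‖) ^ 2 := by
        rw [← Finset.prod_pow, ← Finset.prod_pow, ← Finset.prod_div_distrib]
        refine Finset.prod_congr rfl fun a ha => ?_
        have := hpos a ha
        rw [hp]
        simp only
        rw [sub_eq_iff_eq_add, ← add_div, norm_sub_sq_add, div_self]
        positivity
      have h4 : 0 < ∏ a ∈ S, ‖(x : ℂ) + conj a‖ := Finset.prod_pos hpos
      rw [h3, le_div_iff₀ (by positivity), ← mul_pow]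
      gcongr
    rw [hsq x hx'] at h2
    linarith
  rw [← Finset.mul_sum, mul_div_assoc] at hle
  linarith

/-! ### Comparison of `G(x) = β_h(x)/x` with the mass of `(0, x)` -/

/-- The mass of `(0, x)` under `h dσ`. -/
noncomputable def mass (h : ℝ → ℝ) (x : ℝ) : ℝ := ∫ u in (0 : ℝ)..x, h u

section Weights

variable {h : ℝ → ℝ}

theorem IsDensity.intervalIntegrable (hh : IsDensity h) {a b : ℝ} (ha : 0 ≤ a) (hb : 0 ≤ b) :
    IntervalIntegrable h MeasureTheory.volume a b := by
  rw [intervalIntegrable_iff]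
  refine hh.integrable.mono_set fun u hu => ?_
  rw [uIoc, mem_Ioc] at hu
  exact (le_min ha hb).trans_lt hu.1

theorem IsDensity.mass_eq (_ : IsDensity h) {x : ℝ} (hx : 0 ≤ x) :
    mass h x = ∫ u in Ioo (0 : ℝ) x, h u := by
  rw [mass, intervalIntegral.integral_of_le hx, MeasureTheory.integral_Ioc_eq_integral_Ioo]

theorem IsDensity.mass_pos (hh : IsDensity h) {x : ℝ} (hx : 0 < x) : 0 < mass h x := by
  rw [hh.mass_eq hx.le]
  exact hh.zero_mem_support x hx

theorem IsDensity.beta_div (_ : IsDensity h) {x : ℝ} (hx : 0 < x) :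
    beta h x / x = ∫ u in (0 : ℝ)..x, (1 - u / x) * h u := by
  rw [beta, div_eq_inv_mul, ← intervalIntegral.integral_const_mul]
  refine intervalIntegral.integral_congr fun u _ => ?_
  field_simp

theorem IsDensity.intervalIntegrable_mul (hh : IsDensity h) {x y : ℝ} (hx : 0 ≤ x) :
    IntervalIntegrable (fun u => (1 - u / y) * h u) MeasureTheory.volume 0 x :=
  (hh.intervalIntegrable le_rfl hx).continuousOn_mul (by fun_prop)

theorem IsDensity.beta_div_le_mass (hh : IsDensity h) {x : ℝ} (hx : 0 < x) :
    beta h x / x ≤ mass h x := by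
  rw [hh.beta_div hx, mass]
  refine intervalIntegral.integral_mono_on_of_le_Ioo hx.le (hh.intervalIntegrable_mul hx.le)
    (hh.intervalIntegrable le_rfl hx.le) fun u hu => ?_
  have h1 := hh.nonneg u hu.1
  have h2 : 0 ≤ u / x := div_nonneg hu.1.le hx.le
  nlinarith

/-- The discarded part of the integral, over `(x, y)`, has a nonnegative integrand. -/
theorem IsDensity.integral_mul_mono (hh : IsDensity h) {x y : ℝ} (hx : 0 < x) (hxy : x ≤ y) :
    ∫ u in (0 : ℝ)..x, (1 - u / y) * h u ≤ beta h y / y := by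
  have hy := hx.trans_le hxy
  rw [hh.beta_div hy, ← sub_nonneg, intervalIntegral.integral_interval_sub_left
    (hh.intervalIntegrable_mul hy.le) (hh.intervalIntegrable_mul hx.le),
    intervalIntegral.integral_of_le hxy]
  refine MeasureTheory.setIntegral_nonneg measurableSet_Ioc fun u hu => ?_
  have : u / y ≤ 1 := (div_le_one hy).2 hu.2
  exact mul_nonneg (by linarith) (hh.nonneg u (hx.trans hu.1))

theorem IsDensity.beta_div_mono (hh : IsDensity h) {x y : ℝ} (hx : 0 < x) (hxy : x ≤ y) :
    beta h x / x ≤ beta h y / y := by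
  refine le_trans ?_ (hh.integral_mul_mono hx hxy)
  rw [hh.beta_div hx]
  refine intervalIntegral.integral_mono_on_of_le_Ioo hx.le (hh.intervalIntegrable_mul hx.le)
    (hh.intervalIntegrable_mul hx.le) fun u hu => ?_
  have : u / y ≤ u / x := div_le_div_of_nonneg_left hu.1.le hx hxy
  exact mul_le_mul_of_nonneg_right (by linarith) (hh.nonneg u hu.1)

/-- On `(0, x)` the factor `1 - u/(2x)` is at least `1/2`. With `beta_div_le_mass` this makes mass
and `G` interchangeable up to constants. -/
theorem IsDensity.mass_le_two_mul (hh : IsDensity h) {x : ℝ} (hx : 0 < x) :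
    mass h x ≤ 2 * (beta h (2 * x) / (2 * x)) := by
  have h1 := hh.integral_mul_mono hx (show x ≤ 2 * x by linarith)
  have h2 : mass h x / 2 ≤ ∫ u in (0 : ℝ)..x, (1 - u / (2 * x)) * h u := by
    rw [mass, div_eq_inv_mul, ← intervalIntegral.integral_const_mul]
    refine intervalIntegral.integral_mono_on_of_le_Ioo hx.le
      ((hh.intervalIntegrable le_rfl hx.le).const_mul _)
      (hh.intervalIntegrable_mul hx.le) fun u hu => ?_
    have : u / (2 * x) ≤ 1 / 2 := by
      rw [div_le_div_iff₀ (by positivity) two_pos]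
      linarith [hu.2]
    exact mul_le_mul_of_nonneg_right (by linarith) (hh.nonneg u hu.1)
  linarith

theorem IsDensity.beta_div_pos (hh : IsDensity h) {x : ℝ} (hx : 0 < x) : 0 < beta h x / x := by
  have h1 := hh.mass_le_two_mul (half_pos hx)
  have h2 := hh.mass_pos (half_pos hx)
  rw [mul_div_cancel₀ x two_ne_zero] at h1
  linarith

theorem IsDensity.beta_pos (hh : IsDensity h) {x : ℝ} (hx : 0 < x) : 0 < beta h x := by
  have := mul_pos (hh.beta_div_pos hx) hx
  rwa [div_mul_cancel₀ _ hx.ne'] at this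

end Weights

/-! ### The counting function -/

section Counting

variable {h : ℝ → ℝ} {Φ : ℂ → ℂ}

/-- Monotonicity of `G` linearizes each term, `β(Re a) ≤ G(r) Re a`, and the Littlewood inequality
`hΦ` sums the real parts. -/
theorem nevanlinna_le (hh : IsDensity h) {c : ℝ}
    (hΦ : ∀ w : ℂ, 0 < w.re → ∀ S : Finset ℂ, (∀ a ∈ S, a ∈ halfPlane 0 ∧ Φ a = w) →
      ∑ a ∈ S, a.re ≤ w.re / c) {s : ℂ} (hs : 0 < s.re) {r : ℝ} (hr : 0 < r)
    (hle : ∀ a ∈ halfPlane 0, Φ a = s → a.re ≤ r) :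
    nevanlinna (beta h) Φ s ≤ ENNReal.ofReal (beta h r / r * (s.re / c)) := by
  classical
  rw [nevanlinna, ENNReal.tsum_eq_iSup_sum]
  refine iSup_le fun S => ?_
  have h0 : ∀ a : {a : ℂ // a ∈ halfPlane 0 ∧ Φ a = s}, 0 < (a : ℂ).re := fun a => a.2.1
  rw [← ENNReal.ofReal_sum_of_nonneg fun a _ => (hh.beta_pos (h0 a)).le]
  refine ENNReal.ofReal_le_ofReal ?_
  have h1 := hΦ s hs (S.map (Function.Embedding.subtype _)) (by
    intro a ha
    obtain ⟨b, _, rfl⟩ := Finset.mem_map.1 ha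
    exact b.2)
  rw [Finset.sum_map] at h1
  refine le_trans ?_ (mul_le_mul_of_nonneg_left h1 (hh.beta_div_pos hr).le)
  rw [Finset.mul_sum]
  refine Finset.sum_le_sum fun a _ => ?_
  refine (div_le_iff₀ (h0 a)).1 ?_
  exact hh.beta_div_mono (h0 a) (hle _ a.2.1 a.2.2)

theorem eventually_reToZero {p : ℂ → Prop} (hp : ∀ᶠ s in reToZero, p s) :
    ∃ δ : ℝ, 0 < δ ∧ ∀ s : ℂ, 0 < s.re → s.re < δ → p s := by
  rw [reToZero, eventually_comap, eventually_nhdsWithin_iff, Metric.eventually_nhds_iff] at hp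
  obtain ⟨δ, hδ, H⟩ := hp
  refine ⟨δ, hδ, fun s hs hsδ => H ?_ hs s rfl⟩
  rwa [dist_zero_right, Real.norm_of_nonneg hs.le]

/-- The consequence of `(κ)`: along small scales, `G(ησ) ≤ ε G(σ)`. -/
theorem Kappa.exists_eventually_le (hh : IsDensity h) (hκ : Kappa (beta h)) {ε : ℝ} (hε : 0 < ε) :
    ∃ η : ℝ, 0 < η ∧ ∀ᶠ σ in 𝓝[>] (0 : ℝ),
      beta h (η * σ) / (η * σ) ≤ ε * (beta h σ / σ) := by
  have h1 := hκ.eventually (gt_mem_nhds (ENNReal.ofReal_pos.2 hε))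
  obtain ⟨η, h2, hη⟩ := (h1.and self_mem_nhdsWithin).exists
  refine ⟨η, hη, ?_⟩
  filter_upwards [eventually_lt_of_limsup_lt h2, self_mem_nhdsWithin] with σ hσ hσ0
  rw [ENNReal.ofReal_lt_ofReal_iff hε, div_lt_iff₀ (hh.beta_div_pos hσ0)] at hσ
  exact hσ.le

theorem nevanlinna_isLittleO (hh : IsDensity h) (hκ : Kappa (beta h)) {c : ℝ} (hc : 1 ≤ c)
    (hΦ : ∀ w : ℂ, 0 < w.re → ∀ S : Finset ℂ, (∀ a ∈ S, a ∈ halfPlane 0 ∧ Φ a = w) →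
      ∑ a ∈ S, a.re ≤ w.re / c)
    (hlim : Tendsto (fun s : ℂ => s.re / (Φ s).re) reToZero (𝓝 0)) :
    (fun s : ℂ => (nevanlinna (beta h) Φ s).toReal) =o[reToZero] fun s : ℂ => beta h s.re := by
  rw [isLittleO_iff]
  intro ε hε
  obtain ⟨η, hη, hη'⟩ := hκ.exists_eventually_le hh hε
  obtain ⟨δ, hδ, hδ'⟩ := eventually_reToZero (hlim.eventually (gt_mem_nhds hη))
  rw [reToZero, eventually_comap]
  filter_upwards [hη', self_mem_nhdsWithin, nhdsWithin_le_nhds (gt_mem_nhds hδ)] with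
    σ h1 h2 h3 s hs
  subst hs
  have h2 : 0 < s.re := h2
  have hle : ∀ a ∈ halfPlane 0, Φ a = s → a.re ≤ η * s.re := by
    intro a ha has
    -- Littlewood for one preimage places `a` in the strip `Re a < δ`, where the hypothesis on `Re a
    -- / Re Φ(a)` applies.
    have h4 : a.re ≤ s.re := by
      have := hΦ s h2 {a} (by simpa using ⟨ha, has⟩)
      rw [Finset.sum_singleton] at this
      exact this.trans (div_le_self h2.le hc)
    have h5 := hδ' a ha (h4.trans_lt h3)
    rw [has, div_lt_iff₀ h2] at h5
    exact h5.le
  have h6 := nevanlinna_le hh hΦ h2 (mul_pos hη h2) hle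
  rw [Real.norm_of_nonneg ENNReal.toReal_nonneg, Real.norm_of_nonneg (hh.beta_pos h2).le]
  refine ENNReal.toReal_le_of_le_ofReal (by have := hh.beta_pos h2; positivity)
    (h6.trans (ENNReal.ofReal_le_ofReal ?_))
  calc _ ≤ ε * (beta h s.re / s.re) * s.re :=
        mul_le_mul h1 (div_le_self h2.le hc) (by positivity)
          (mul_nonneg hε.le (hh.beta_div_pos h2).le)
    _ = _ := by field_simp

theorem nevanlinna_ne_top (hh : IsDensity h) {c : ℝ} (hc : 1 ≤ c)
    (hΦ : ∀ w : ℂ, 0 < w.re → ∀ S : Finset ℂ, (∀ a ∈ S, a ∈ halfPlane 0 ∧ Φ a = w) →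
      ∑ a ∈ S, a.re ≤ w.re / c) {s : ℂ} (hs : 0 < s.re) : nevanlinna (beta h) Φ s ≠ ⊤ := by
  refine ne_top_of_le_ne_top ENNReal.ofReal_ne_top
    (nevanlinna_le hh hΦ hs hs fun a ha has => ?_)
  have := hΦ s hs {a} (by simpa using ⟨ha, has⟩)
  rw [Finset.sum_singleton] at this
  exact this.trans (div_le_self hs.le hc)

end Counting

/-! ### Dirichlet series over smooth integers and power-bounded series -/

section Smooth

open LSeries

/-- The restriction of a sequence to the `N`-smooth numbers. -/
noncomputable def smoothPart (N : ℕ) (f : ℕ → ℂ) : ℕ → ℂ := (Nat.smoothNumbers N).indicator f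

/-- A product of positive integers is smooth exactly when both factors are, so truncation to smooth
numbers respects multiplication of Dirichlet series. -/
theorem smoothPart_convolution (N : ℕ) (f g : ℕ → ℂ) :
    smoothPart N (convolution f g) = convolution (smoothPart N f) (smoothPart N g) := by
  funext n
  simp only [convolution_def]
  by_cases hn : n ∈ Nat.smoothNumbers N
  · rw [smoothPart, indicator_of_mem hn]
    refine Finset.sum_congr rfl fun p hp => ?_
    have hp' := (Nat.mem_divisorsAntidiagonal.1 hp).1
    rw [smoothPart, smoothPart,
      indicator_of_mem (Nat.mem_smoothNumbers_of_dvd hn ⟨p.2, hp'.symm⟩),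
      indicator_of_mem (Nat.mem_smoothNumbers_of_dvd hn ⟨p.1, by rw [← hp', mul_comm]⟩)]
  · rw [smoothPart, indicator_of_notMem hn]
    refine (Finset.sum_eq_zero fun p hp => ?_).symm
    have hp' := (Nat.mem_divisorsAntidiagonal.1 hp).1
    by_cases h1 : p.1 ∈ Nat.smoothNumbers N
    · have h2 : p.2 ∉ Nat.smoothNumbers N := fun h2 =>
        hn (hp' ▸ Nat.mul_mem_smoothNumbers h1 h2)
      rw [smoothPart, smoothPart, indicator_of_notMem h2, mul_zero]
    · rw [smoothPart, indicator_of_notMem h1, zero_mul]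

theorem norm_term_smoothPart_le (N : ℕ) (f : ℕ → ℂ) (s : ℂ) (n : ℕ) :
    ‖term (smoothPart N f) s n‖ ≤ ‖term f s n‖ :=
  norm_term_le s (norm_indicator_le_norm_self _ _)

theorem tendsto_LSeries_smoothPart {f : ℕ → ℂ} {s : ℂ} (hf : LSeriesSummable f s) :
    Tendsto (fun N => LSeries (smoothPart N f) s) atTop (𝓝 (LSeries f s)) := by
  refine tendsto_tsum_of_dominated_convergence (bound := fun n => ‖term f s n‖) hf.norm
    (fun n => ?_) (Eventually.of_forall fun N n => norm_term_smoothPart_le N f s n)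
  rcases eq_or_ne n 0 with rfl | hn
  · simp
  refine tendsto_const_nhds.congr' ?_
  filter_upwards [eventually_gt_atTop n] with N hN
  rw [term_of_ne_zero hn, term_of_ne_zero hn, smoothPart,
    indicator_of_mem (Nat.mem_smoothNumbers_of_lt (Nat.pos_of_ne_zero hn) hN)]

theorem logMul_iterate_smoothPart (N m : ℕ) (f : ℕ → ℂ) :
    logMul^[m] (smoothPart N f) = smoothPart N (logMul^[m] f) := by
  induction m with
  | zero => rfl
  | succ m ih =>
    rw [Function.iterate_succ_apply', Function.iterate_succ_apply', ih]
    funext n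
    by_cases hn : n ∈ Nat.smoothNumbers N
    · simp [smoothPart, logMul, hn]
    · simp [smoothPart, logMul, hn]

/-- An Euler product over finitely many primes converges for every `x > 0`; this is what lets smooth
parts live on the whole right half-plane. -/
theorem summable_smooth_rpow (N : ℕ) {x : ℝ} (hx : 0 < x) :
    Summable ((Nat.smoothNumbers N).indicator fun n : ℕ => (n : ℝ) ^ (-x)) := by
  let f : ℕ →* ℝ :=
    { toFun := fun n => (n : ℝ) ^ (-x)
      map_one' := by simp
      map_mul' := fun a b => by
        rw [Nat.cast_mul, Real.mul_rpow (Nat.cast_nonneg _) (Nat.cast_nonneg _)] }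
  have h := (EulerProduct.summable_and_hasSum_smoothNumbers_prod_primesBelow_geometric (f := f)
    (fun {p} hp => by
      have h1 : (1 : ℝ) < p := by exact_mod_cast hp.one_lt
      show ‖(p : ℝ) ^ (-x)‖ < 1
      rw [Real.norm_of_nonneg (by positivity)]
      exact Real.rpow_lt_one_of_one_lt_of_neg h1 (by linarith)) N).2.summable
  exact summable_subtype_iff_indicator.1 h

theorem norm_term_smoothPart_le_rpow (N : ℕ) {f : ℕ → ℂ} {C e : ℝ}
    (hf : ∀ n ≠ 0, ‖f n‖ ≤ C * (n : ℝ) ^ e) (s : ℂ) (n : ℕ) :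
    ‖term (smoothPart N f) s n‖ ≤
      C * (Nat.smoothNumbers N).indicator (fun n : ℕ => (n : ℝ) ^ (-(s.re - e))) n := by
  by_cases hn : n ∈ Nat.smoothNumbers N
  · have h0 : n ≠ 0 := Nat.ne_zero_of_mem_smoothNumbers hn
    have h1 : (0 : ℝ) < n := by exact_mod_cast Nat.pos_of_ne_zero h0
    rw [term_of_ne_zero h0, smoothPart, indicator_of_mem hn, indicator_of_mem hn, norm_div,
      Complex.norm_natCast_cpow_of_pos (Nat.pos_of_ne_zero h0), neg_sub, Real.rpow_sub h1,
      ← mul_div_assoc]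
    gcongr
    exact hf n h0
  · rw [indicator_of_notMem hn, mul_zero, term_def, smoothPart, indicator_of_notMem hn]
    simp

theorem LSeriesSummable_smoothPart (N : ℕ) {f : ℕ → ℂ} {C e : ℝ}
    (hf : ∀ n ≠ 0, ‖f n‖ ≤ C * (n : ℝ) ^ e) {s : ℂ} (hs : e < s.re) :
    LSeriesSummable (smoothPart N f) s :=
  .of_norm_bounded ((summable_smooth_rpow N (sub_pos.2 hs)).mul_left C)
    (norm_term_smoothPart_le_rpow N hf s)

theorem le_one_of_pow_succ_le {x C : ℝ} (h : ∀ k : ℕ, x ^ (k + 1) ≤ C) : x ≤ 1 := by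
  by_contra! hx
  obtain ⟨k, hk⟩ :=
    ((tendsto_pow_atTop_atTop_of_one_lt hx).eventually_gt_atTop C).exists_forall_of_atTop
  exact (h k).not_gt (hk (k + 1) (Nat.le_succ k))

/-- If all powers of a Dirichlet series have coefficients `O(n^e)`, uniformly in the power and for
every `e > 0`, then its smooth parts are bounded by `1` on the right half-plane. -/
theorem norm_LSeries_smoothPart_le_one {B : ℕ → ℕ → ℂ}
    (hB : ∀ e : ℝ, 0 < e → ∃ C : ℝ, ∀ k, ∀ n ≠ 0, ‖B k n‖ ≤ C * (n : ℝ) ^ e)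
    (hmul : ∀ k, ∀ n ≠ 0, B (k + 1) n = convolution (B k) (B 0) n) (N : ℕ) {s : ℂ}
    (hs : s ∈ halfPlane 0) : ‖LSeries (smoothPart N (B 0)) s‖ ≤ 1 := by
  have hs' : 0 < s.re := hs
  obtain ⟨C, hC⟩ := hB (s.re / 2) (by linarith)
  have hsum : ∀ k, LSeriesSummable (smoothPart N (B k)) s := fun k =>
    LSeriesSummable_smoothPart N (hC k) (by linarith)
  have hpow : ∀ k, LSeries (smoothPart N (B k)) s = LSeries (smoothPart N (B 0)) s ^ (k + 1) := by
    intro k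
    induction k with
    | zero => simp
    | succ k ih =>
      rw [pow_succ, ← ih, ← LSeries_convolution' (hsum k) (hsum 0), ← smoothPart_convolution]
      refine LSeries_congr (fun {n} hn => ?_) s
      by_cases hs : n ∈ Nat.smoothNumbers N
      · simp [smoothPart, hs, hmul k n hn]
      · simp [smoothPart, hs]
  -- The bound does not depend on `k`: `C` serves all powers with exponent `e = Re s / 2`, leaving
  -- the convergent exponent `Re s / 2`.
  refine le_one_of_pow_succ_le (C := ∑' n, C * (Nat.smoothNumbers N).indicator
    (fun n : ℕ => (n : ℝ) ^ (-(s.re - s.re / 2))) n) fun k => ?_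
  rw [← norm_pow, ← hpow k]
  exact tsum_of_norm_bounded ((summable_smooth_rpow N (by linarith)).mul_left C).hasSum
    (norm_term_smoothPart_le_rpow N (hC k) s)

/-- The smooth parts converge to `G` with all derivatives at a point far to the right. Being bounded
by `1`, they have Taylor coefficients there dominated by Cauchy's estimates, so convergence
propagates to `s`. -/
theorem norm_le_one_of_LSeries_smoothPart {b : ℕ → ℂ} {G : ℂ → ℂ}
    (hb : ∀ e : ℝ, 0 < e → ∃ C : ℝ, ∀ n ≠ 0, ‖b n‖ ≤ C * (n : ℝ) ^ e)
    (hN : ∀ N, ∀ s ∈ halfPlane 0, ‖LSeries (smoothPart N b) s‖ ≤ 1)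
    (hG : DifferentiableOn ℂ G (halfPlane 0))
    (hGb : ∀ s : ℂ, 2 < s.re → LSeries b s = G s) {s : ℂ} (hs : s ∈ halfPlane 0) : ‖G s‖ ≤ 1 := by
  have hσ : 0 < s.re := hs
  have habs : abscissaOfAbsConv b ≤ ((2 : ℝ) : EReal) := by
    obtain ⟨C, hC⟩ := hb 1 one_pos
    refine (abscissaOfAbsConv_le_of_le_const_mul_rpow ⟨C, hC⟩).trans (le_of_eq ?_)
    rw [← EReal.coe_one, ← EReal.coe_add]
    norm_num
  have habsN : ∀ N, abscissaOfAbsConv (smoothPart N b) ≤ 0 := by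
    intro N
    refine abscissaOfAbsConv_le_of_forall_lt_LSeriesSummable fun y hy => ?_
    have hy : 0 < y := by exact_mod_cast hy
    obtain ⟨C, hC⟩ := hb (y / 2) (by linarith)
    exact LSeriesSummable_smoothPart N hC (by simpa using hy)
  have hdiffN : ∀ N, DifferentiableOn ℂ (LSeries (smoothPart N b)) (halfPlane 0) := by
    intro N
    refine (LSeries_differentiableOn _).mono fun z hz => ?_
    have hz : 0 < z.re := hz
    exact (habsN N).trans_lt (by exact_mod_cast hz)
  -- The closed disc about `X` of radius `r` stops at abscissa `Re s / 2`, inside the half-plane.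
  -- `X` is large enough that `|s - X| < r`, and the `+ 3` puts it in `Re > 2`, where `G` is the sum
  -- of the series.
  set X : ℝ := (s.re ^ 2 + s.im ^ 2) / s.re + 3 with hX
  set r : ℝ := X - s.re / 2 with hr
  have hXσ : X * s.re = s.re ^ 2 + s.im ^ 2 + 3 * s.re := by
    rw [hX]
    field_simp
  have hX1 : s.re + 3 ≤ X := by
    by_contra! h
    nlinarith [sq_nonneg s.im]
  have hr0 : 0 < r := by linarith
  have hsr : ‖s - X‖ < r := by
    refine lt_of_pow_lt_pow_left₀ 2 hr0.le ?_
    rw [← Complex.normSq_eq_norm_sq, Complex.normSq_apply]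
    simp
    rw [hr]
    nlinarith [sq_nonneg s.im]
  have hball : Metric.closedBall (X : ℂ) r ⊆ halfPlane 0 := by
    intro z hz
    rw [Metric.mem_closedBall, dist_eq_norm] at hz
    have h1 := (Complex.abs_re_le_norm (z - X)).trans hz
    have h2 := (abs_le.1 h1).1
    simp at h2
    show 0 < z.re
    linarith
  have hX2 : (2 : ℝ) < (X : ℂ).re := by simp; linarith
  have habX : abscissaOfAbsConv b < (X : ℂ).re :=
    habs.trans_lt (EReal.coe_lt_coe_iff.2 hX2)
  have hiter : ∀ j, Tendsto (fun N => iteratedDeriv j (LSeries (smoothPart N b)) X) atTop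
      (𝓝 (iteratedDeriv j G X)) := by
    intro j
    have hev : G =ᶠ[𝓝 (X : ℂ)] LSeries b := by
      filter_upwards [(isOpen_halfPlane 2).mem_nhds hX2] with z hz
      exact (hGb z hz).symm
    rw [hev.iteratedDeriv_eq, LSeries_iteratedDeriv j habX]
    have h1 : ∀ N, iteratedDeriv j (LSeries (smoothPart N b)) X =
        (-1) ^ j * LSeries (smoothPart N (logMul^[j] b)) X := by
      intro N
      rw [LSeries_iteratedDeriv j, logMul_iterate_smoothPart]
      exact (habsN N).trans_lt (by exact_mod_cast (two_pos.trans hX2))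
    simp only [h1]
    refine (tendsto_LSeries_smoothPart ?_).const_mul _
    refine LSeriesSummable_of_abscissaOfAbsConv_lt_re ?_
    rwa [absicssaOfAbsConv_logPowMul]
  have hmem : s ∈ Metric.ball (X : ℂ) r := by rwa [Metric.mem_ball, dist_eq_norm]
  have hsub := Metric.ball_subset_closedBall.trans hball
  have hlim : Tendsto (fun N => LSeries (smoothPart N b) s) atTop (𝓝 (G s)) := by
    rw [← Complex.taylorSeries_eq_on_ball' hmem (hG.mono hsub)]
    simp only [fun N => (Complex.taylorSeries_eq_on_ball' hmem ((hdiffN N).mono hsub)).symm]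
    refine tendsto_tsum_of_dominated_convergence (bound := fun j => (‖s - X‖ / r) ^ j)
      (summable_geometric_of_lt_one (by positivity) ((div_lt_one hr0).2 hsr))
      (fun j => ((hiter j).const_mul _).mul_const _) (Eventually.of_forall fun N j => ?_)
    have h1 := Complex.norm_iteratedDeriv_le_of_forall_mem_sphere_norm_le (C := 1) j hr0
      (((hdiffN N).mono hball).diffContOnCl_ball subset_rfl)
      (fun z hz => hN N z (hball (Metric.sphere_subset_closedBall hz)))
    have h2 : (0 : ℝ) < j.factorial := by exact_mod_cast j.factorial_pos
    rw [norm_mul, norm_mul, norm_inv, norm_pow, Complex.norm_natCast, div_pow, div_eq_mul_inv,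
      mul_comm]
    gcongr
    rw [inv_mul_le_iff₀ h2]
    refine h1.trans (le_of_eq ?_)
    rw [mul_one, div_eq_mul_inv]
  exact le_of_tendsto hlim.norm (Eventually.of_forall fun N => hN N s hs)

end Smooth

/-! ### Coefficients in the space, and the range and growth of the symbol -/

section Space

variable {h : ℝ → ℝ}

theorem rpow_le_one_of_pnat (n : ℕ+) {x : ℝ} (hx : x ≤ 0) : (n : ℝ) ^ x ≤ 1 :=
  Real.rpow_le_one_of_one_le_of_nonpos (Nat.one_le_cast.2 n.pos) hx

theorem pnat_cast_pos (n : ℕ+) : (0 : ℝ) < n := by exact_mod_cast n.pos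

theorem IsDensity.integrableOn_rpow_mul (hh : IsDensity h) (n : ℕ+) {K : ℝ} (hK : 0 ≤ K) :
    MeasureTheory.IntegrableOn (fun σ => (n : ℝ) ^ (-2 * (K * σ)) * h σ) (Ioi 0) := by
  refine hh.integrable.bdd_mul (c := 1) ?_ ?_
  · exact Continuous.aestronglyMeasurable
      (Continuous.rpow continuous_const (by fun_prop) fun _ => Or.inl (pnat_cast_pos n).ne')
  · filter_upwards [MeasureTheory.ae_restrict_mem measurableSet_Ioi] with σ hσ
    have hσ : 0 < σ := hσ
    rw [Real.norm_of_nonneg (Real.rpow_nonneg (pnat_cast_pos n).le _)]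
    exact rpow_le_one_of_pnat n (by nlinarith [mul_nonneg hK hσ.le])

theorem IsDensity.integrableOn_weight (hh : IsDensity h) (n : ℕ+) :
    MeasureTheory.IntegrableOn (fun σ => (n : ℝ) ^ (-2 * σ) * h σ) (Ioi 0) := by
  simpa using hh.integrableOn_rpow_mul n zero_le_one

/-- Keep only `σ < e` in the integral. As `0` lies in the support, the weights decay more slowly
than any power of `n`. -/
theorem IsDensity.rpow_mul_mass_le (hh : IsDensity h) (n : ℕ+) {e : ℝ} (he : 0 < e) :
    (n : ℝ) ^ (-2 * e) * mass h e ≤ weight h n := by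
  have hsub : Ioo (0 : ℝ) e ⊆ Ioi 0 := fun x hx => hx.1
  rw [hh.mass_eq he.le, ← MeasureTheory.integral_const_mul, weight]
  refine le_trans ?_ (MeasureTheory.setIntegral_mono_set (s := Ioo 0 e) (hh.integrableOn_weight n)
    ?_ hsub.eventuallyLE)
  · refine MeasureTheory.setIntegral_mono_on ((hh.integrable.mono_set hsub).const_mul _)
      ((hh.integrableOn_weight n).mono_set hsub) measurableSet_Ioo fun σ hσ => ?_
    refine mul_le_mul_of_nonneg_right ?_ (hh.nonneg σ hσ.1)
    exact Real.rpow_le_rpow_of_exponent_le (Nat.one_le_cast.2 n.pos) (by linarith [hσ.2])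
  · filter_upwards [MeasureTheory.ae_restrict_mem measurableSet_Ioi] with σ hσ
    exact mul_nonneg (Real.rpow_nonneg (pnat_cast_pos n).le _) (hh.nonneg σ hσ)

theorem IsDensity.weight_pos (hh : IsDensity h) (n : ℕ+) : 0 < weight h n :=
  (mul_pos (Real.rpow_pos_of_pos (pnat_cast_pos n) _) (hh.mass_pos one_pos)).trans_le
    (hh.rpow_mul_mass_le n one_pos)

theorem IsDensity.weight_le_one (hh : IsDensity h) (n : ℕ+) : weight h n ≤ 1 := by
  rw [← hh.integral_eq_one, weight]
  refine MeasureTheory.setIntegral_mono_on (hh.integrableOn_weight n) hh.integrable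
    measurableSet_Ioi fun σ hσ => ?_
  have hσ' : 0 < σ := hσ
  exact mul_le_of_le_one_left (hh.nonneg σ hσ) (rpow_le_one_of_pnat n (by linarith))

theorem IsDensity.norm_coeff_le (hh : IsDensity h) (g : Bergman h) (n : ℕ+) {e : ℝ} (he : 0 < e) :
    ‖coeff h g n‖ ≤ ‖g‖ / √(mass h e) * (n : ℝ) ^ e := by
  have hn := pnat_cast_pos n
  have hm := Real.sqrt_pos.2 (hh.mass_pos he)
  have h1 : (n : ℝ) ^ (-e) * √(mass h e) ≤ √(weight h n) := by
    refine Real.le_sqrt_of_sq_le ?_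
    rw [mul_pow, Real.sq_sqrt (hh.mass_pos he).le, ← Real.rpow_natCast, ← Real.rpow_mul hn.le]
    convert hh.rpow_mul_mass_le n he using 3
    push_cast
    ring
  have h2 := lp.norm_apply_le_norm (by simp) g n
  rw [coeff, norm_div, Complex.norm_real, Real.norm_of_nonneg (Real.sqrt_nonneg _)]
  calc ‖g n‖ / √(weight h n) ≤ ‖g‖ / ((n : ℝ) ^ (-e) * √(mass h e)) := by gcongr
    _ = _ := by
      rw [Real.rpow_neg hn.le]
      field_simp

/-- The Dirichlet coefficients as a sequence indexed by `ℕ`. -/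
noncomputable def dirichletCoeff (h : ℝ → ℝ) (g : Bergman h) (n : ℕ) : ℂ :=
  if hn : 0 < n then coeff h g ⟨n, hn⟩ else 0

theorem dirichletCoeff_coe (g : Bergman h) (n : ℕ+) : dirichletCoeff h g n = coeff h g n := by
  rw [dirichletCoeff, dif_pos n.pos]
  rfl

theorem eval_eq_LSeries (g : Bergman h) (s : ℂ) : eval h g s = LSeries (dirichletCoeff h g) s := by
  rw [eval, LSeries, ← PNat.coe_injective.tsum_eq]
  · refine tsum_congr fun n => ?_
    rw [LSeries.term_of_ne_zero n.ne_zero, dirichletCoeff_coe, Complex.cpow_neg, div_eq_mul_inv]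
  · intro n hn
    rcases Nat.eq_zero_or_pos n with rfl | hn'
    · simp at hn
    · exact ⟨⟨n, hn'⟩, rfl⟩

theorem IsDensity.norm_dirichletCoeff_le (hh : IsDensity h) (g : Bergman h) {e : ℝ} (he : 0 < e)
    (n : ℕ) (hn : n ≠ 0) : ‖dirichletCoeff h g n‖ ≤ ‖g‖ / √(mass h e) * (n : ℝ) ^ e := by
  have := hh.norm_coeff_le g ⟨n, Nat.pos_of_ne_zero hn⟩ he
  rwa [dirichletCoeff, dif_pos (Nat.pos_of_ne_zero hn)]

theorem IsDensity.lseriesSummable_dirichletCoeff (hh : IsDensity h) (g : Bergman h) {s : ℂ}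
    (hs : 1 < s.re) : LSeriesSummable (dirichletCoeff h g) s :=
  LSeriesSummable_of_le_const_mul_rpow (x := (s.re + 1) / 2) (by linarith)
    ⟨_, hh.norm_dirichletCoeff_le g (by linarith)⟩

theorem IsDensity.abscissa_dirichletCoeff_lt_top (hh : IsDensity h) (g : Bergman h) :
    LSeries.abscissaOfAbsConv (dirichletCoeff h g) < ⊤ :=
  (LSeriesSummable.abscissaOfAbsConv_le
    (hh.lseriesSummable_dirichletCoeff g (s := 2) (by norm_num))).trans_lt (EReal.coe_lt_top _)

/-- The Dirichlet monomial `n^{-s}`. -/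
noncomputable def monomial (h : ℝ → ℝ) (n : ℕ+) : Bergman h :=
  lp.single 2 n ((√(weight h n) : ℝ) : ℂ)

theorem IsDensity.eval_monomial (hh : IsDensity h) (n : ℕ+) (s : ℂ) :
    eval h (monomial h n) s = (n : ℂ) ^ (-s) := by
  have hw : ((√(weight h n) : ℝ) : ℂ) ≠ 0 := by
    exact_mod_cast (Real.sqrt_pos.2 (hh.weight_pos n)).ne'
  rw [eval, tsum_eq_single n]
  · rw [coeff, monomial, lp.single_apply_self, div_self hw, one_mul]
  · intro m hm
    rw [coeff, monomial, lp.single_apply_ne _ _ _ hm, zero_div, zero_mul]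

theorem IsDensity.norm_monomial_le_one (hh : IsDensity h) (n : ℕ+) : ‖monomial h n‖ ≤ 1 := by
  rw [monomial, lp.norm_single (by norm_num), Complex.norm_real,
    Real.norm_of_nonneg (Real.sqrt_nonneg _)]
  exact Real.sqrt_le_one.2 (hh.weight_le_one n)

theorem two_pow_cpow (z : ℂ) (k : ℕ) : ((2 ^ k : ℕ) : ℂ) ^ z = ((2 : ℂ) ^ z) ^ k := by
  induction k with
  | zero => simp
  | succ k ih =>
    rw [pow_succ, Nat.cast_mul, Complex.natCast_mul_natCast_cpow, ih, pow_succ, Nat.cast_ofNat]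

/-- A bounded composition operator has a symbol with nonnegative real part on the right
half-plane. -/
theorem IsCompositionOperator.re_nonneg (hh : IsDensity h) {Φ : ℂ → ℂ}
    {T : Bergman h →L[ℂ] Bergman h} (hT : IsCompositionOperator h Φ T)
    (hext : DifferentiableOn ℂ Φ (halfPlane 0)) {s : ℂ} (hs : s ∈ halfPlane 0) :
    0 ≤ (Φ s).re := by
  -- `B k` holds the coefficients of `G^(k+1)`; the shift makes `B 0` those of `G` itself. The claim
  -- `Re Φ ≥ 0` is `|G| ≤ 1`.
  set B : ℕ → ℕ → ℂ := fun k => dirichletCoeff h (T (monomial h (2 ^ (k + 1)))) with hBdef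
  set G : ℂ → ℂ := fun s => (2 : ℂ) ^ (-Φ s) with hGdef
  have hG : DifferentiableOn ℂ G (halfPlane 0) :=
    hext.neg.const_cpow (Or.inl two_ne_zero)
  have hBG : ∀ k, ∀ s : ℂ, 1 / 2 < s.re → LSeries (B k) s = G s ^ (k + 1) := by
    intro k s hs
    rw [hBdef, ← eval_eq_LSeries, hT _ s hs, hh.eval_monomial, hGdef, ← two_pow_cpow]
    simp
  have hTk : ∀ k : ℕ, ‖T (monomial h (2 ^ (k + 1)))‖ ≤ ‖T‖ := fun k =>
    (T.le_opNorm _).trans (mul_le_of_le_one_right (norm_nonneg _) (hh.norm_monomial_le_one _))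
  have hB : ∀ e : ℝ, 0 < e → ∃ C : ℝ, ∀ k, ∀ n ≠ 0, ‖B k n‖ ≤ C * (n : ℝ) ^ e := by
    intro e he
    refine ⟨‖T‖ / √(mass h e), fun k n hn => (hh.norm_dirichletCoeff_le _ he n hn).trans ?_⟩
    have := hTk k
    gcongr
  have hsumm : ∀ k, ∀ s : ℂ, 1 < s.re → LSeriesSummable (B k) s := fun k s hs =>
    hh.lseriesSummable_dirichletCoeff _ hs
  -- Uniqueness of Dirichlet coefficients applied to `G^(k+2) = G^(k+1) G`.
  have hmul : ∀ k, ∀ n ≠ 0, B (k + 1) n = LSeries.convolution (B k) (B 0) n := by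
    intro k n hn
    refine LSeries.eq_of_LSeries_eventually_eq (hh.abscissa_dirichletCoeff_lt_top _) ?_ ?_ hn
    · exact (LSeries.abscissaOfAbsConv_convolution_le _ _).trans_lt
        (max_lt (hh.abscissa_dirichletCoeff_lt_top _) (hh.abscissa_dirichletCoeff_lt_top _))
    · filter_upwards [eventually_gt_atTop (1 : ℝ)] with x hx
      have hx' : 1 < (x : ℂ).re := by simpa using hx
      rw [LSeries_convolution' (hsumm k _ hx') (hsumm 0 _ hx'), hBG _ _ (by linarith),
        hBG _ _ (by linarith), hBG _ _ (by linarith)]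
      ring
  have key := norm_le_one_of_LSeries_smoothPart (b := B 0) (G := G)
    (fun e he => (hB e he).imp fun C hC => hC 0)
    (fun N s hs => norm_LSeries_smoothPart_le_one hB hmul N hs) hG
    (fun s hs => by rw [hBG 0 s (by linarith), zero_add, pow_one]) hs
  by_contra! hneg
  have h1 : ‖G s‖ = (2 : ℝ) ^ (-(Φ s).re) := by
    have := Complex.norm_cpow_eq_rpow_re_of_pos two_pos (-Φ s)
    simpa [hGdef] using this
  rw [h1] at key
  exact key.not_gt (Real.one_lt_rpow one_lt_two (by linarith))

/-- Convergence at one point `y` bounds the terms there, so the series converges absolutely one unit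
further right and is dominated by its absolute sum at `y + 2`. -/
theorem InClassD.eventually_bounded {φ : ℂ → ℂ} (hφ : InClassD φ) :
    ∃ C : ℝ, ∀ᶠ x : ℝ in atTop, ‖φ x‖ ≤ C := by
  obtain ⟨a, θ, hconv⟩ := hφ
  set y : ℝ := θ + 1 with hy
  have hyθ : (y : ℂ) ∈ halfPlane θ := by simp [halfPlane, hy]
  have h0 := hconv y hyθ
  have h1 : Tendsto (fun N : ℕ => a (N + 1) * ((N + 1 : ℕ) : ℂ) ^ (-(y : ℂ))) atTop (𝓝 0) := by
    have := ((tendsto_add_atTop_iff_nat 1).2 h0).sub h0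
    rw [sub_self] at this
    refine this.congr fun N => ?_
    rw [Finset.sum_Icc_succ_top (Nat.le_add_left 1 N), add_sub_cancel_left]
  obtain ⟨M, hM⟩ := h1.norm.bddAbove_range
  -- The exponent is left as `y + 1 - 1` to match `LSeriesSummable_of_le_const_mul_rpow` with
  -- abscissa `y + 1`.
  have ha : ∀ n ≠ 0, ‖a n‖ ≤ M * (n : ℝ) ^ (y + 1 - 1) := by
    intro n hn
    obtain ⟨m, rfl⟩ := Nat.exists_eq_succ_of_ne_zero hn
    have h2 : ‖a (m + 1) * ((m + 1 : ℕ) : ℂ) ^ (-(y : ℂ))‖ ≤ M := hM ⟨m, rfl⟩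
    have h3 : (0 : ℝ) < ((m + 1 : ℕ) : ℝ) := by positivity
    rw [norm_mul, Complex.norm_natCast_cpow_of_pos m.succ_pos, Complex.neg_re, Complex.ofReal_re,
      Real.rpow_neg h3.le, ← div_eq_mul_inv, div_le_iff₀ (by positivity)] at h2
    rw [add_sub_cancel_right]
    exact h2
  have hsum : ∀ x : ℝ, y + 1 < x → LSeriesSummable a x := fun x hx =>
    LSeriesSummable_of_le_const_mul_rpow (x := y + 1) (by simpa using hx) ⟨M, ha⟩
  refine ⟨∑' n, ‖LSeries.term a ((y + 2 : ℝ) : ℂ) n‖, ?_⟩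
  filter_upwards [eventually_gt_atTop (y + 2)] with x hx
  have hφx : φ x = LSeries a x := by
    refine tendsto_nhds_unique (hconv x ?_) ?_
    · simp only [halfPlane, mem_ofPred_eq, Complex.ofReal_re]
      linarith
    · refine ((tendsto_add_atTop_iff_nat 1).2
        (hsum x (by linarith)).LSeriesHasSum.tendsto_sum_nat).congr fun N => ?_
      refine (Finset.sum_subset_zero_on_sdiff (fun n hn => ?_) (fun n hn => ?_)
        fun n hn => ?_).symm
      · rw [Finset.mem_Icc] at hn
        exact Finset.mem_range.2 (by omega)
      · have : n = 0 := by
          simp at hn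
          omega
        rw [this, LSeries.term_zero]
      · have : n ≠ 0 := by
          rw [Finset.mem_Icc] at hn
          omega
        rw [LSeries.term_of_ne_zero this, Complex.cpow_neg, div_eq_mul_inv]
  rw [hφx]
  refine tsum_of_norm_bounded (hsum (y + 2) (by linarith)).norm.hasSum fun n => ?_
  exact LSeries.norm_term_le_of_re_le_re a (by simpa using hx.le) n

theorem InClassD.tendsto_div {Φ : ℂ → ℂ} {c : ℂ} (hΦ : InClassD fun s => Φ s - c * s) :
    Tendsto (fun x : ℝ => Φ x / x) atTop (𝓝 c) := by
  obtain ⟨C, hC⟩ := hΦ.eventually_bounded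
  have h1 : Tendsto (fun x : ℝ => (Φ x - c * x) / x) atTop (𝓝 0) := by
    refine squeeze_zero_norm' (a := fun x : ℝ => C * x⁻¹) ?_ ?_
    · filter_upwards [hC, eventually_gt_atTop (0 : ℝ)] with x hx hx0
      rw [norm_div, Complex.norm_real, Real.norm_of_nonneg hx0.le, div_eq_mul_inv]
      gcongr
    · simpa using tendsto_inv_atTop_zero.const_mul C
  have h2 := h1.add_const c
  rw [zero_add] at h2
  refine h2.congr' ?_
  filter_upwards [eventually_gt_atTop (0 : ℝ)] with x hx
  have : (x : ℂ) ≠ 0 := by exact_mod_cast hx.ne'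
  field_simp
  ring

/-- The Littlewood inequality with the single preimage `s`, applied to `Φ + ε` so that the target
value has positive real part. -/
theorem mul_re_le_re {Φ : ℂ → ℂ} (hext : DifferentiableOn ℂ Φ (halfPlane 0))
    (hre : ∀ s ∈ halfPlane 0, 0 ≤ (Φ s).re) {c : ℝ} (hc : 0 < c)
    (hlim : Tendsto (fun x : ℝ => Φ x / x) atTop (𝓝 c)) {s : ℂ} (hs : s ∈ halfPlane 0) :
    c * s.re ≤ (Φ s).re := by
  refine le_of_forall_pos_le_add fun ε hε => ?_
  have hinv : Tendsto (fun x : ℝ => (ε : ℂ) / (x : ℂ)) atTop (𝓝 0) := by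
    have : Tendsto (fun x : ℝ => (((ε / x : ℝ)) : ℂ)) atTop (𝓝 ((0 : ℝ) : ℂ)) :=
      (Complex.continuous_ofReal.tendsto 0).comp (tendsto_const_nhds.div_atTop tendsto_id)
    simpa using this
  have h1 := sum_re_le_of_mapsTo (Ψ := fun s => Φ s + ε) (w := Φ s + ε) (hext.add_const _)
    (fun z hz => by simpa using add_nonneg (hre z hz) hε.le) hc
    (by simpa [add_div] using hlim.add hinv)
    (by simpa using add_pos_of_nonneg_of_pos (hre s hs) hε) {s} (by simpa using hs)
  rw [Finset.sum_singleton, le_div_iff₀ hc] at h1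
  simp at h1
  linarith

end Space

/-! ### Mean values on vertical lines -/

section Mean

open Complex MeasureTheory

/-- The mean of `E` over the segment `[x - iT, x + iT]`. -/
noncomputable def vmean (E : ℂ → ℂ) (x T : ℝ) : ℂ :=
  (2 * T : ℂ)⁻¹ * ∫ t in (-T)..T, E (x + t * I)

/-- `E` is continuous on the line `Re s = x`, with mean value `L`. -/
structure HasMean (E : ℂ → ℂ) (x : ℝ) (L : ℂ) : Prop where
  cont : Continuous fun t : ℝ => E (x + t * I)
  tendsto : Tendsto (vmean E x) atTop (𝓝 L)

theorem norm_two_mul_inv {T : ℝ} (hT : 0 < T) : ‖(2 * T : ℂ)⁻¹‖ = (2 * T)⁻¹ := by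
  rw [norm_inv, norm_mul, Complex.norm_real, Real.norm_of_nonneg hT.le]
  norm_num

theorem norm_vmean_le {E : ℂ → ℂ} {x T C : ℝ} (hT : 0 < T)
    (hE : ∀ t : ℝ, ‖E (x + t * I)‖ ≤ C) : ‖vmean E x T‖ ≤ C := by
  have h1 := intervalIntegral.norm_integral_le_of_norm_le_const (a := -T) (b := T)
    (f := fun t : ℝ => E (x + t * I)) (C := C) fun t _ => hE t
  rw [sub_neg_eq_add, abs_of_pos (by linarith)] at h1
  rw [vmean, norm_mul, norm_two_mul_inv hT, inv_mul_le_iff₀ (by linarith)]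
  linarith

namespace HasMean

variable {E E' : ℂ → ℂ} {x : ℝ} {L L' : ℂ}

theorem add (h : HasMean E x L) (h' : HasMean E' x L') :
    HasMean (fun s => E s + E' s) x (L + L') := by
  refine ⟨h.cont.add h'.cont, (h.tendsto.add h'.tendsto).congr fun T => ?_⟩
  rw [vmean, vmean, vmean, ← mul_add, intervalIntegral.integral_add
    (h.cont.intervalIntegrable _ _) (h'.cont.intervalIntegrable _ _)]

theorem const_mul (h : HasMean E x L) (c : ℂ) : HasMean (fun s => c * E s) x (c * L) := by
  refine ⟨h.cont.const_mul _, (h.tendsto.const_mul c).congr fun T => ?_⟩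
  rw [vmean, vmean, intervalIntegral.integral_const_mul]
  ring

theorem zero : HasMean (fun _ => 0) x 0 :=
  ⟨continuous_const, tendsto_const_nhds.congr fun T => by simp [vmean]⟩

theorem sum {ι : Type*} {S : Finset ι} {E : ι → ℂ → ℂ} {L : ι → ℂ}
    (h : ∀ i ∈ S, HasMean (E i) x (L i)) :
    HasMean (fun s => ∑ i ∈ S, E i s) x (∑ i ∈ S, L i) := by
  classical
  induction S using Finset.induction_on with
  | empty => simpa using zero
  | insert a S ha ih =>
    simp only [Finset.sum_insert ha]
    exact (h a (Finset.mem_insert_self _ _)).add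
      (ih fun i hi => h i (Finset.mem_insert_of_mem hi))

theorem congr (h : HasMean E x L) (hE : ∀ t : ℝ, E (x + t * I) = E' (x + t * I)) :
    HasMean E' x L := by
  refine ⟨h.cont.congr hE, h.tendsto.congr fun T => ?_⟩
  simp only [vmean, hE]

theorem re_nonneg (h : HasMean E x L) (hE : ∀ t : ℝ, 0 ≤ (E (x + t * I)).re) : 0 ≤ L.re := by
  refine ge_of_tendsto ((Complex.continuous_re.tendsto _).comp h.tendsto) ?_
  filter_upwards [eventually_gt_atTop (0 : ℝ)] with T hT
  have h1 : (vmean E x T).re = (2 * T)⁻¹ * ∫ t in (-T)..T, (E (x + t * I)).re := by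
    have h2 := Complex.reCLM.intervalIntegral_comp_comm
      (h.cont.intervalIntegrable (μ := volume) (-T) T)
    simp only [Complex.reCLM_apply] at h2
    rw [h2, vmean, show (2 * T : ℂ)⁻¹ = (((2 * T)⁻¹ : ℝ) : ℂ) by push_cast; rfl,
      Complex.re_ofReal_mul]
  rw [Function.comp_apply, h1]
  refine mul_nonneg (by positivity) ?_
  exact intervalIntegral.integral_nonneg (by linarith) fun t _ => hE t

end HasMean

/-- By Cauchy's theorem on a rectangle, the two vertical integrals differ only by the horizontal
sides, which stay bounded and vanish after division by `2T`. -/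
theorem tendsto_vmean_sub {E : ℂ → ℂ} (hE : DifferentiableOn ℂ E (halfPlane 0)) {x y M : ℝ}
    (hx : 0 < x) (hxy : x ≤ y) (hM : ∀ s : ℂ, x ≤ s.re → s.re ≤ y → ‖E s‖ ≤ M) :
    Tendsto (fun T => vmean E x T - vmean E y T) atTop (𝓝 0) := by
  refine squeeze_zero_norm' (a := fun T => (M * (y - x)) * T⁻¹) ?_
    (by simpa using tendsto_inv_atTop_zero.const_mul (M * (y - x)))
  filter_upwards [eventually_gt_atTop (0 : ℝ)] with T hT
  have h1 := Complex.integral_boundary_rect_eq_zero_of_differentiableOn E ⟨x, -T⟩ ⟨y, T⟩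
    (hE.mono fun s hs => by
      have := hs.1
      simp only [mem_preimage, uIcc_of_le hxy, mem_Icc] at this
      exact hx.trans_le this.1)
  simp only [smul_eq_mul] at h1
  have hb : ∀ c : ℝ, ‖∫ u in x..y, E (u + c * I)‖ ≤ M * (y - x) := by
    intro c
    have := intervalIntegral.norm_integral_le_of_norm_le_const (a := x) (b := y)
      (f := fun u : ℝ => E (u + c * I)) (C := M) fun u hu => by
        rw [uIoc_of_le hxy] at hu
        exact hM _ (by simpa using hu.1.le) (by simpa using hu.2)
    rwa [abs_of_nonneg (by linarith)] at this
  have h2 : vmean E x T - vmean E y T = (2 * T : ℂ)⁻¹ * ((-I) *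
      ((∫ u in x..y, E (u + (-T : ℝ) * I)) - ∫ u in x..y, E (u + T * I))) := by
    rw [vmean, vmean, ← mul_sub]
    congr 1
    linear_combination I * h1 + ((∫ t in (-T)..T, E (x + t * I)) -
      ∫ t in (-T)..T, E (y + t * I)) * Complex.I_sq
  rw [h2, norm_mul, norm_two_mul_inv hT, norm_mul, norm_neg, Complex.norm_I, one_mul]
  have h3 := (norm_sub_le (∫ u in x..y, E (u + (-T : ℝ) * I)) (∫ u in x..y, E (u + T * I))).trans
    (add_le_add (hb (-T)) (hb T))
  rw [mul_comm (M * (y - x)), inv_mul_le_iff₀ (by linarith)]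
  refine h3.trans (le_of_eq ?_)
  field_simp
  ring

theorem continuous_line {E : ℂ → ℂ} (hE : DifferentiableOn ℂ E (halfPlane 0)) {x : ℝ}
    (hx : 0 < x) : Continuous fun t : ℝ => E (x + t * I) :=
  hE.continuousOn.comp_continuous (by fun_prop) fun t => by simpa [halfPlane] using hx

/-- A bounded function that is uniformly small far to the right has mean value zero. -/
theorem hasMean_zero {E : ℂ → ℂ} (hE : DifferentiableOn ℂ E (halfPlane 0)) {x M : ℝ} (hx : 0 < x)
    (hM : ∀ s : ℂ, x ≤ s.re → ‖E s‖ ≤ M)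
    (h0 : ∀ ε > 0, ∃ y, x ≤ y ∧ ∀ s : ℂ, s.re = y → ‖E s‖ ≤ ε) : HasMean E x 0 := by
  refine ⟨continuous_line hE hx, ?_⟩
  rw [Metric.tendsto_nhds]
  intro ε hε
  obtain ⟨y, hxy, hy⟩ := h0 (ε / 2) (half_pos hε)
  have h1 := tendsto_vmean_sub hE hx hxy fun s hs _ => hM s hs
  rw [Metric.tendsto_nhds] at h1
  filter_upwards [h1 (ε / 2) (half_pos hε), eventually_gt_atTop (0 : ℝ)] with T hT hT0
  rw [dist_zero_right] at hT ⊢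
  have h2 : ‖vmean E y T‖ ≤ ε / 2 := norm_vmean_le hT0 fun t => hy _ (by simp)
  calc ‖vmean E x T‖ = ‖(vmean E x T - vmean E y T) + vmean E y T‖ := by rw [sub_add_cancel]
    _ ≤ _ := norm_add_le _ _
    _ < ε := by linarith

/-- Orthogonality of the characters `n^{-it}`: for `p ≠ q` the integrand is a constant times
`exp(ilt)` with `l = log q - log p ≠ 0`, whose primitive is bounded. -/
theorem hasMean_cpow_mul_cpow {p q : ℕ} (hp : p ≠ 0) (hq : q ≠ 0) (x : ℝ) :
    HasMean (fun s => (p : ℂ) ^ (-s) * (q : ℂ) ^ s) x (if p = q then 1 else 0) := by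
  have hp' : (p : ℂ) ≠ 0 := by exact_mod_cast hp
  have hq' : (q : ℂ) ≠ 0 := by exact_mod_cast hq
  have hcont : Continuous fun t : ℝ => (p : ℂ) ^ (-(x + t * I : ℂ)) * (q : ℂ) ^ (x + t * I : ℂ) :=
    (Continuous.const_cpow (by fun_prop) (Or.inl hp')).mul
      (Continuous.const_cpow (by fun_prop) (Or.inl hq'))
  refine ⟨hcont, ?_⟩
  split_ifs with hpq
  · subst hpq
    refine tendsto_const_nhds.congr' ?_
    filter_upwards [eventually_gt_atTop (0 : ℝ)] with T hT
    have : (T : ℂ) ≠ 0 := by exact_mod_cast hT.ne'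
    simp only [vmean, ← Complex.cpow_add _ _ hp', neg_add_cancel, Complex.cpow_zero,
      intervalIntegral.integral_const, sub_neg_eq_add]
    rw [Complex.real_smul]
    push_cast
    field_simp
    ring
  · set l : ℝ := Real.log q - Real.log p with hl
    have hl0 : l ≠ 0 := by
      intro h
      have h1 := Real.log_injOn_pos (by simpa using Nat.pos_of_ne_zero hq)
        (by simpa using Nat.pos_of_ne_zero hp) (sub_eq_zero.1 h)
      exact hpq (by exact_mod_cast h1.symm)
    have hc : (l * I : ℂ) ≠ 0 := mul_ne_zero (by exact_mod_cast hl0) I_ne_zero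
    have hexp : ∀ t : ℝ, (p : ℂ) ^ (-(x + t * I : ℂ)) * (q : ℂ) ^ (x + t * I : ℂ) =
        cexp (l * x) * cexp (l * I * t) := by
      intro t
      rw [Complex.cpow_def_of_ne_zero hp', Complex.cpow_def_of_ne_zero hq', ← Complex.exp_add,
        ← Complex.exp_add, ← Complex.natCast_log, ← Complex.natCast_log, hl]
      congr 1
      push_cast
      ring
    have hn : ∀ t : ℝ, ‖cexp (l * I * t)‖ = 1 := fun t => by
      rw [Complex.norm_exp]
      simp
    refine squeeze_zero_norm' (a := fun T => (‖cexp (l * x)‖ * |l|⁻¹) * T⁻¹) ?_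
      (by simpa using tendsto_inv_atTop_zero.const_mul (‖cexp (l * x)‖ * |l|⁻¹))
    filter_upwards [eventually_gt_atTop (0 : ℝ)] with T hT
    simp only [vmean, hexp]
    rw [intervalIntegral.integral_const_mul, integral_exp_mul_complex hc, norm_mul,
      norm_two_mul_inv hT, norm_mul, norm_div, norm_mul (l : ℂ), Complex.norm_I, mul_one,
      Complex.norm_real, Real.norm_eq_abs]
    have h2 : ‖cexp (l * I * T) - cexp (l * I * (-T : ℝ))‖ ≤ 2 :=
      (norm_sub_le _ _).trans (by rw [hn, hn]; norm_num)
    have h3 : 0 < |l| := abs_pos.2 hl0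
    calc _ ≤ (2 * T)⁻¹ * (‖cexp (l * x)‖ * (2 / |l|)) := by gcongr
      _ = _ := by field_simp

/-- On a line of absolute convergence, sum and mean may be interchanged, and orthogonality selects
the coefficient. -/
theorem tendsto_vmean_LSeries_mul {b : ℕ → ℂ} {y : ℝ} (hb : LSeriesSummable b y) {m : ℕ}
    (hm : m ≠ 0) : Tendsto (vmean (fun s => LSeries b s * (m : ℂ) ^ s) y) atTop (𝓝 (b m)) := by
  have hnorm : ∀ (k : ℕ) (t : ℝ), ‖LSeries.term b (y + t * I) k * (m : ℂ) ^ (y + t * I : ℂ)‖ =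
      ‖LSeries.term b y k‖ * (m : ℝ) ^ y := by
    intro k t
    rw [norm_mul, Complex.norm_natCast_cpow_of_pos (Nat.pos_of_ne_zero hm), LSeries.norm_term_eq,
      LSeries.norm_term_eq]
    simp
  have hterm : ∀ k, HasMean (fun s => LSeries.term b s k * (m : ℂ) ^ s) y
      (if k = m then b m else 0) := by
    intro k
    rcases eq_or_ne k 0 with rfl | hk
    · simpa [hm.symm] using HasMean.zero
    · have h1 := (hasMean_cpow_mul_cpow hk hm y).const_mul (b k)
      have h2 : b k * (if k = m then 1 else 0) = if k = m then b m else 0 := by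
        split_ifs with h
        · rw [h, mul_one]
        · rw [mul_zero]
      rw [h2] at h1
      refine h1.congr fun t => ?_
      rw [LSeries.term_of_ne_zero hk, Complex.cpow_neg]
      ring
  have hsumm := hb.norm.mul_right ((m : ℝ) ^ y)
  have hswap : ∀ T, vmean (fun s => LSeries b s * (m : ℂ) ^ s) y T =
      ∑' k, vmean (fun s => LSeries.term b s k * (m : ℂ) ^ s) y T := by
    intro T
    simp only [vmean]
    rw [tsum_mul_left]
    congr 1
    refine (intervalIntegral.hasSum_integral_of_dominated_convergence
      (bound := fun k _ => ‖LSeries.term b y k‖ * (m : ℝ) ^ y)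
      (fun k => (hterm k).cont.aestronglyMeasurable)
      (fun k => Eventually.of_forall fun t _ => (hnorm k t).le)
      (Eventually.of_forall fun t _ => hsumm) (by simp)
      (Eventually.of_forall fun t _ => ?_)).tsum_eq.symm
    have h1 : Summable fun k => LSeries.term b (y + t * I) k * (m : ℂ) ^ (y + t * I : ℂ) :=
      .of_norm_bounded hsumm fun k => (hnorm k t).le
    have h2 := h1.hasSum
    rwa [tsum_mul_right] at h2
  have hlim := tendsto_tsum_of_dominated_convergence (𝓕 := atTop)
    (f := fun T k => vmean (fun s => LSeries.term b s k * (m : ℂ) ^ s) y T)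
    hsumm (fun k => (hterm k).tendsto)
    (by
      filter_upwards [eventually_gt_atTop (0 : ℝ)] with T hT k
      exact norm_vmean_le hT fun t => (hnorm k t).le)
  rw [tsum_ite_eq] at hlim
  exact hlim.congr fun T => (hswap T).symm

end Mean

/-! ### Positive kernels and the subordination principle -/

section Subordination

open Complex ComplexConjugate

theorem sum_sum_mul_conj_re {ι : Type*} (S : Finset ι) (d : ι → ℂ) :
    ∑ n ∈ S, ∑ k ∈ S, (d n * conj (d k)).re = ‖∑ n ∈ S, d n‖ ^ 2 := by
  have h : (∑ n ∈ S, d n) * conj (∑ n ∈ S, d n) = ((‖∑ n ∈ S, d n‖ ^ 2 : ℝ) : ℂ) := by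
    rw [Complex.mul_conj, Complex.normSq_eq_norm_sq]
  have h2 := congrArg Complex.re h
  rw [map_sum, Finset.sum_mul_sum, Complex.ofReal_re] at h2
  rw [← h2]
  simp only [Complex.re_sum]

/-- For `q` nonnegative and nondecreasing, the kernel `q (min m n)` is positive semidefinite. -/
theorem sum_mul_min_nonneg {ι : Type*} (S : Finset ι) (c : ι → ℂ) (v : ι → ℕ) {q : ℕ → ℝ}
    (hq : Monotone q) (h0 : 0 ≤ q 0) :
    0 ≤ ∑ n ∈ S, ∑ k ∈ S, (c n * conj (c k)).re * q (min (v n) (v k)) := by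
  set M := S.sup v with hM
  -- Layer-cake form of `q`: the kernel becomes a nonnegative combination of the rank-one kernels
  -- `1_{j < v n} 1_{j < v k}` and the constant one.
  have hqm : ∀ m ≤ M, q m = q 0 + ∑ j ∈ Finset.range M, if j < m then q (j + 1) - q j else 0 := by
    intro m hm
    rw [← Finset.sum_filter, show (Finset.range M).filter (· < m) = Finset.range m by
      ext j
      simp only [Finset.mem_filter, Finset.mem_range]
      omega, Finset.sum_range_sub]
    ring
  have key : ∑ n ∈ S, ∑ k ∈ S, (c n * conj (c k)).re * q (min (v n) (v k)) =
      q 0 * ‖∑ n ∈ S, c n‖ ^ 2 + ∑ j ∈ Finset.range M, (q (j + 1) - q j) *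
        ‖∑ n ∈ S, if j < v n then c n else 0‖ ^ 2 := by
    simp only [← sum_sum_mul_conj_re]
    calc _ = ∑ n ∈ S, ∑ k ∈ S, (q 0 * (c n * conj (c k)).re + ∑ j ∈ Finset.range M,
          (q (j + 1) - q j) * ((if j < v n then c n else 0) *
            conj (if j < v k then c k else 0)).re) := by
          refine Finset.sum_congr rfl fun n hn => Finset.sum_congr rfl fun k _ => ?_
          rw [hqm _ ((min_le_left _ _).trans (Finset.le_sup hn)), mul_add, Finset.mul_sum, mul_comm]
          congr 1
          refine Finset.sum_congr rfl fun j _ => ?_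
          by_cases h1 : j < v n <;> by_cases h2 : j < v k <;> simp [h1, h2, mul_comm]
      _ = _ := by
          simp only [Finset.sum_add_distrib, Finset.mul_sum]
          congr 1
          simp only [Finset.sum_comm (t := Finset.range M)]
  rw [key]
  refine add_nonneg (by positivity) (Finset.sum_nonneg fun j _ => ?_)
  exact mul_nonneg (sub_nonneg.2 (hq (Nat.le_succ j))) (by positivity)

theorem pnat_cast_ne_zero (n : ℕ+) : (n : ℂ) ≠ 0 := by exact_mod_cast n.ne_zero

/-- On a line of fixed `Re w`, this replaces conjugate terms by holomorphic ones. -/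
theorem conj_cpow_neg (k : ℕ+) (w : ℂ) :
    conj ((k : ℂ) ^ (-w)) = ((k : ℝ) ^ (-2 * w.re) : ℝ) * (k : ℂ) ^ w := by
  have hw : w + conj w = ((2 * w.re : ℝ) : ℂ) := by
    rw [Complex.add_conj]
  have hconj : conj ((k : ℂ) ^ (-w)) = (k : ℂ) ^ conj (-w) := by
    rw [Complex.cpow_conj _ _ (by rw [Complex.natCast_arg]; exact Real.pi_ne_zero.symm),
      Complex.conj_natCast]
  rw [hconj, Complex.ofReal_cpow (pnat_cast_pos k).le, Complex.ofReal_natCast,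
    ← Complex.cpow_add _ _ (pnat_cast_ne_zero k)]
  congr 1
  rw [map_neg]
  push_cast at hw ⊢
  linear_combination -hw

/-- The holomorphic function whose real part is the harmonic extension from the line `Re w = μ` of
the part of `|∑ aₙ n^{-w}|²` with indices `n, k`. -/
noncomputable def harmonicTerm (a : ℕ+ → ℂ) (μ : ℝ) (n k : ℕ+) (w : ℂ) : ℂ :=
  if k ≤ n then a n * conj (a k) * ((k : ℝ) ^ (-2 * μ) : ℝ) * ((n : ℂ) ^ (-w) * (k : ℂ) ^ w)
  else a k * conj (a n) * ((n : ℝ) ^ (-2 * μ) : ℝ) * ((k : ℂ) ^ (-w) * (n : ℂ) ^ w)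

theorem mul_conj_mul_rpow (a : ℕ+ → ℂ) (μ : ℝ) (n k : ℕ+) (w : ℂ) :
    (a n * (n : ℂ) ^ (-w)) * conj (a k * (k : ℂ) ^ (-w)) * ((k : ℝ) ^ (2 * (w.re - μ)) : ℝ) =
      a n * conj (a k) * ((k : ℝ) ^ (-2 * μ) : ℝ) * ((n : ℂ) ^ (-w) * (k : ℂ) ^ w) := by
  rw [map_mul, conj_cpow_neg]
  have : ((k : ℝ) ^ (-2 * μ)) = (k : ℝ) ^ (-2 * w.re) * (k : ℝ) ^ (2 * (w.re - μ)) := by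
    rw [← Real.rpow_add (pnat_cast_pos k)]
    congr 1
    ring
  rw [this]
  push_cast
  ring

/-- The two branches of `harmonicTerm` exchange `n` and `k`, which conjugates the Gram entry and
leaves its real part unchanged. -/
theorem harmonicTerm_re (a : ℕ+ → ℂ) (μ : ℝ) (n k : ℕ+) (w : ℂ) :
    (harmonicTerm a μ n k w).re = ((a n * (n : ℂ) ^ (-w)) * conj (a k * (k : ℂ) ^ (-w))).re *
      ((min (n : ℕ) k : ℕ) : ℝ) ^ (2 * (w.re - μ)) := by
  rw [harmonicTerm]
  split_ifs with h
  · rw [min_eq_right (by exact_mod_cast h), ← mul_conj_mul_rpow, Complex.re_mul_ofReal]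
  · rw [min_eq_left (by exact_mod_cast (not_le.1 h).le), ← mul_conj_mul_rpow,
      Complex.re_mul_ofReal]
    congr 1
    rw [← Complex.conj_re]
    congr 1
    simp only [map_mul, Complex.conj_conj]
    ring

/-- Subharmonicity made algebraic: the difference of the two sides is the quadratic form of the
kernel `min(n, k)^{2(Re w - μ)} - 1`, which is positive semidefinite. -/
theorem norm_sum_sq_le_harmonic (S : Finset ℕ+) (a : ℕ+ → ℂ) {μ : ℝ} {w : ℂ} (hw : μ ≤ w.re) :
    ‖∑ n ∈ S, a n * (n : ℂ) ^ (-w)‖ ^ 2 ≤ (∑ n ∈ S, ∑ k ∈ S, harmonicTerm a μ n k w).re := by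
  -- The formula would give `-1` at `m = 0` for a positive exponent, breaking `0 ≤ q 0`; the indices
  -- are positive, so the value there is free.
  set q : ℕ → ℝ := fun m => if m = 0 then 0 else (m : ℝ) ^ (2 * (w.re - μ)) - 1 with hq
  have hmono : Monotone q := by
    refine monotone_nat_of_le_succ fun m => ?_
    rcases Nat.eq_zero_or_pos m with rfl | hm
    · simp [hq]
    · simp only [hq, hm.ne', Nat.succ_ne_zero, if_false]
      have : (m : ℝ) ≤ (m + 1 : ℕ) := by exact_mod_cast Nat.le_succ m
      have h2 : 0 ≤ 2 * (w.re - μ) := by linarith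
      gcongr
  have key := sum_mul_min_nonneg S (fun n => a n * (n : ℂ) ^ (-w)) (fun n => (n : ℕ)) hmono
    (by simp [hq])
  have hqv : ∀ n k : ℕ+, q (min (n : ℕ) k) =
      ((min (n : ℕ) k : ℕ) : ℝ) ^ (2 * (w.re - μ)) - 1 := fun n k => by
    have : min (n : ℕ) k ≠ 0 := (lt_min n.pos k.pos).ne'
    simp only [hq, this, if_false]
  simp only [hqv, mul_sub_one, Finset.sum_sub_distrib, ← harmonicTerm_re] at key
  rw [sum_sum_mul_conj_re] at key
  simp only [Complex.re_sum]
  linarith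

variable {Φ : ℂ → ℂ}

/-- Orthogonality survives composition: for `r < p` the modulus is at most `(r/p)^{Re s}`, which
decays uniformly to the right. -/
theorem hasMean_cpow_comp (hext : DifferentiableOn ℂ Φ (halfPlane 0))
    (hre : ∀ s ∈ halfPlane 0, s.re ≤ (Φ s).re) {x : ℝ} (hx : 0 < x) {p r : ℕ+} (hrp : r ≤ p) :
    HasMean (fun s => (p : ℂ) ^ (-Φ s) * (r : ℂ) ^ Φ s) x (if p = r then 1 else 0) := by
  split_ifs with h
  · subst h
    have h1 := hasMean_cpow_mul_cpow p.ne_zero p.ne_zero x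
    rw [if_pos rfl] at h1
    refine h1.congr fun t => ?_
    simp only [← Complex.cpow_add _ _ (pnat_cast_ne_zero p), neg_add_cancel]
  · have hp := pnat_cast_pos p
    have hr := pnat_cast_pos r
    have hlt : (r : ℝ) / p < 1 := by
      rw [div_lt_one hp]
      exact_mod_cast lt_of_le_of_ne hrp (Ne.symm h)
    have hbase : 0 < (r : ℝ) / p := by positivity
    have hn : ∀ s ∈ halfPlane 0,
        ‖(p : ℂ) ^ (-Φ s) * (r : ℂ) ^ Φ s‖ ≤ ((r : ℝ) / p) ^ s.re := by
      intro s hs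
      rw [norm_mul, Complex.norm_natCast_cpow_of_pos p.pos, Complex.norm_natCast_cpow_of_pos r.pos,
        Complex.neg_re, Real.rpow_neg hp.le, inv_mul_eq_div, ← Real.div_rpow hr.le hp.le]
      exact Real.rpow_le_rpow_of_exponent_ge hbase hlt.le (hre s hs)
    refine hasMean_zero ?_ hx (M := 1) (fun s hs => ?_) fun ε hε => ?_
    · exact (hext.neg.const_cpow (Or.inl (pnat_cast_ne_zero p))).mul
        (hext.const_cpow (Or.inl (pnat_cast_ne_zero r)))
    · have hs0 : 0 < s.re := hx.trans_le hs
      exact (hn s hs0).trans (Real.rpow_le_one hbase.le hlt.le hs0.le)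
    · have h1 := tendsto_rpow_atTop_of_base_lt_one _ (by linarith) hlt
      obtain ⟨y, hy, hxy⟩ := ((h1.eventually (gt_mem_nhds hε)).and (eventually_ge_atTop x)).exists
      refine ⟨y, hxy, fun s hs => (hn s ?_).trans (by rw [hs]; exact hy.le)⟩
      show 0 < s.re
      linarith

theorem hasMean_harmonicTerm (hext : DifferentiableOn ℂ Φ (halfPlane 0))
    (hre : ∀ s ∈ halfPlane 0, s.re ≤ (Φ s).re) {x : ℝ} (hx : 0 < x) (a : ℕ+ → ℂ) (μ : ℝ)
    (n k : ℕ+) : HasMean (fun s => harmonicTerm a μ n k (Φ s)) x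
      (if n = k then ((‖a n‖ ^ 2 * (n : ℝ) ^ (-2 * μ) : ℝ) : ℂ) else 0) := by
  simp only [harmonicTerm]
  by_cases h : k ≤ n
  · simp only [h, if_true]
    have h1 := (hasMean_cpow_comp hext hre hx h).const_mul
      (a n * conj (a k) * ((k : ℝ) ^ (-2 * μ) : ℝ))
    convert h1 using 1
    split_ifs with hnk
    · subst hnk
      rw [Complex.mul_conj, Complex.normSq_eq_norm_sq]
      push_cast
      ring
    · ring
  · simp only [h, if_false]
    have h1 := (hasMean_cpow_comp hext hre hx (not_le.1 h).le).const_mul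
      (a k * conj (a n) * ((n : ℝ) ^ (-2 * μ) : ℝ))
    convert h1 using 1
    have hnk : n ≠ k := (not_le.1 h).ne
    rw [if_neg hnk, if_neg hnk.symm, mul_zero]

/-- The subordination principle for Dirichlet polynomials: composition with `Φ` maps the norm over
the line `Re s = μ` to the norm over the line `Re s = x`, contractively. -/
theorem sum_norm_sq_le_of_subordinate (hext : DifferentiableOn ℂ Φ (halfPlane 0))
    (hre : ∀ s ∈ halfPlane 0, s.re ≤ (Φ s).re) (S : Finset ℕ+) (a : ℕ+ → ℂ) {b : ℕ → ℂ}
    (hb : ∀ s : ℂ, 1 < s.re → LSeriesSummable b s)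
    (hbF : ∀ s : ℂ, 1 < s.re → LSeries b s = ∑ n ∈ S, a n * (n : ℂ) ^ (-Φ s))
    {x μ : ℝ} (hx : 0 < x) (hμ : ∀ s : ℂ, x ≤ s.re → μ ≤ (Φ s).re) (R : Finset ℕ+) :
    ∑ m ∈ R, ‖b m‖ ^ 2 * (m : ℝ) ^ (-2 * x) ≤ ∑ n ∈ S, ‖a n‖ ^ 2 * (n : ℝ) ^ (-2 * μ) := by
  set F : ℂ → ℂ := fun s => ∑ n ∈ S, a n * (n : ℂ) ^ (-Φ s) with hF
  have hFd : DifferentiableOn ℂ F (halfPlane 0) :=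
    DifferentiableOn.fun_sum fun n _ =>
      (hext.neg.const_cpow (Or.inl (pnat_cast_ne_zero n))).const_mul _
  have hFb : ∀ s ∈ halfPlane 0, ‖F s‖ ≤ ∑ n ∈ S, ‖a n‖ := by
    intro s hs
    have hs0 : 0 < s.re := hs
    refine norm_sum_le_of_le _ fun n _ => ?_
    rw [norm_mul, Complex.norm_natCast_cpow_of_pos n.pos]
    refine mul_le_of_le_one_right (norm_nonneg _) (rpow_le_one_of_pnat n ?_)
    rw [Complex.neg_re]
    linarith [hre s hs]
  -- The coefficient is read off at `x + 1`, where the series converges absolutely; boundedness of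
  -- `F` moves the mean back to `x`.
  have hFm : ∀ m : ℕ+, HasMean (fun s => F s * (m : ℂ) ^ s) x (b m) := by
    intro m
    have hd : DifferentiableOn ℂ (fun s => F s * (m : ℂ) ^ s) (halfPlane 0) :=
      hFd.mul (differentiableOn_id.const_cpow (Or.inl (pnat_cast_ne_zero m)))
    refine ⟨continuous_line hd hx, ?_⟩
    have h1 := tendsto_vmean_sub hd hx (show x ≤ x + 1 by linarith)
      (M := (∑ n ∈ S, ‖a n‖) * (m : ℝ) ^ (x + 1)) fun s h1 h2 => by
        rw [norm_mul, Complex.norm_natCast_cpow_of_pos m.pos]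
        have h3 := hFb s (hx.trans_le h1)
        have h4 : (1 : ℝ) ≤ m := Nat.one_le_cast.2 m.pos
        gcongr
    have h2 := tendsto_vmean_LSeries_mul (b := b) (y := x + 1) (hb _ (by simpa using hx)) m.ne_zero
    have h3 : vmean (fun s => LSeries b s * (m : ℂ) ^ s) (x + 1) =
        vmean (fun s => F s * (m : ℂ) ^ s) (x + 1) := by
      funext T
      simp only [vmean]
      congr 1
      refine intervalIntegral.integral_congr fun t _ => ?_
      rw [hbF _ (by simpa using hx)]
    rw [h3] at h2
    have h4 := h1.add h2
    rw [zero_add] at h4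
    exact h4.congr fun T => sub_add_cancel _ _
  have hPm : ∀ m ∈ R, HasMean (fun s => ∑ k ∈ R, b k * ((k : ℂ) ^ (-s) * (m : ℂ) ^ s)) x (b m) := by
    intro m hm
    have h1 := HasMean.sum (S := R) fun k _ =>
      (hasMean_cpow_mul_cpow k.ne_zero m.ne_zero x).const_mul (b k)
    simpa [hm] using h1
  set c : ℕ+ → ℂ := fun m => conj (b m) * ((m : ℝ) ^ (-2 * x) : ℝ) with hc
  -- A Bessel argument: on `Re s = x` the real part of this sum is at least `|F - P|² ≥ 0`, with `P`
  -- the partial sum over `R` and `conj P = ∑ c m * m^s`. Its mean is the right side of the claim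
  -- minus the left.
  have hW := ((HasMean.sum (S := S) fun n _ => HasMean.sum (S := S) fun k _ =>
    hasMean_harmonicTerm hext hre hx a μ n k).add
    (HasMean.sum (S := R) fun m _ => (hFm m).const_mul (-2 * c m))).add
    (HasMean.sum (S := R) fun m hm => (hPm m hm).const_mul (c m))
  have hcb : ∀ m : ℕ+, c m * b m = ((‖b m‖ ^ 2 * (m : ℝ) ^ (-2 * x) : ℝ) : ℂ) := by
    intro m
    rw [Complex.ofReal_mul, ← Complex.normSq_eq_norm_sq, ← Complex.mul_conj, hc]
    ring
  have hpos := hW.re_nonneg fun t => by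
    set s : ℂ := x + t * I with hs
    have hsre : s.re = x := by simp [hs]
    have hs0 : s ∈ halfPlane 0 := by
      show 0 < s.re
      rwa [hsre]
    set P : ℂ := ∑ m ∈ R, b m * (m : ℂ) ^ (-s) with hP
    have hconj : conj P = ∑ m ∈ R, c m * (m : ℂ) ^ s := by
      rw [hP, map_sum]
      refine Finset.sum_congr rfl fun m _ => ?_
      rw [map_mul, conj_cpow_neg, hsre, hc]
      ring
    have h1 : ∑ m ∈ R, -2 * c m * (F s * (m : ℂ) ^ s) = -2 * (F s * conj P) := by
      rw [hconj, Finset.mul_sum, Finset.mul_sum]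
      exact Finset.sum_congr rfl fun m _ => by ring
    have h2 : ∑ m ∈ R, c m * ∑ k ∈ R, b k * ((k : ℂ) ^ (-s) * (m : ℂ) ^ s) = P * conj P := by
      rw [hconj, Finset.mul_sum]
      refine Finset.sum_congr rfl fun m _ => ?_
      rw [hP, Finset.mul_sum, Finset.sum_mul]
      exact Finset.sum_congr rfl fun k _ => by ring
    have h3 := norm_sum_sq_le_harmonic S a (hμ s hsre.ge)
    have h4 : ‖F s - P‖ ^ 2 = ‖F s‖ ^ 2 - 2 * (F s * conj P).re + ‖P‖ ^ 2 := by
      rw [← Complex.normSq_eq_norm_sq, ← Complex.normSq_eq_norm_sq, ← Complex.normSq_eq_norm_sq,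
        Complex.normSq_sub]
      ring
    have h5 : (P * conj P).re = ‖P‖ ^ 2 := by
      rw [Complex.mul_conj, Complex.ofReal_re, Complex.normSq_eq_norm_sq]
    have h6 : (-2 * (F s * conj P)).re = -2 * (F s * conj P).re := by
      rw [show (-2 : ℂ) = ((-2 : ℝ) : ℂ) by norm_num, Complex.re_ofReal_mul]
    rw [h1, h2, Complex.add_re, Complex.add_re, h5, h6]
    have h7 := sq_nonneg ‖F s - P‖
    rw [h4] at h7
    linarith
  simp only [mul_assoc, hcb, ← Finset.mul_sum] at hpos
  simp only [Finset.sum_ite_eq, ← Complex.ofReal_sum] at hpos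
  rw [Finset.sum_congr rfl fun n hn => if_pos hn, ← Complex.ofReal_sum,
    show (-2 : ℂ) = ((-2 : ℝ) : ℂ) by norm_num, ← Complex.ofReal_mul, ← Complex.ofReal_add,
    ← Complex.ofReal_add, Complex.ofReal_re] at hpos
  linarith

end Subordination

/-! ### Small tails and compactness -/

section Compactness

open MeasureTheory

variable {h : ℝ → ℝ}

theorem tendsto_log_pnat : Tendsto (fun n : ℕ+ => Real.log n) atTop atTop :=
  Real.tendsto_log_atTop.comp (tendsto_natCast_atTop_atTop.comp tendsto_PNat_val_atTop_atTop)

theorem rpow_inv_log_mul {n : ℕ+} (hn : 0 < Real.log n) (c : ℝ) :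
    (n : ℝ) ^ ((Real.log n)⁻¹ * c) = Real.exp c := by
  rw [Real.rpow_def_of_pos (pnat_cast_pos n), ← mul_assoc, mul_inv_cancel₀ hn.ne', one_mul]

/-- Split at `r`: below it the power is at most `1`, above it the extra factor `n^{-2(K-1)σ}` is at
most `n^{-2(K-1)r}`. -/
theorem IsDensity.integral_rpow_le (hh : IsDensity h) (n : ℕ+) {K r : ℝ} (hK : 1 ≤ K)
    (hr : 0 < r) : ∫ σ in Ioi (0 : ℝ), (n : ℝ) ^ (-2 * (K * σ)) * h σ ≤
      mass h r + (n : ℝ) ^ (r * (-2 * (K - 1))) * weight h n := by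
  have hsub : Ioo (0 : ℝ) r ⊆ Ioi 0 := fun x hx => hx.1
  have hind : IntegrableOn ((Ioo (0 : ℝ) r).indicator h) (Ioi 0) :=
    (hh.integrable.integrable.indicator measurableSet_Ioo)
  have h1 : ∫ σ in Ioi (0 : ℝ), (Ioo (0 : ℝ) r).indicator h σ = mass h r := by
    rw [hh.mass_eq hr.le, setIntegral_indicator measurableSet_Ioo,
      inter_eq_self_of_subset_right hsub]
  rw [← h1, weight, ← integral_const_mul, ← integral_add hind
    ((hh.integrableOn_weight n).const_mul _)]
  refine setIntegral_mono_on (hh.integrableOn_rpow_mul n (by linarith))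
    (hind.add ((hh.integrableOn_weight n).const_mul _)) measurableSet_Ioi fun σ hσ => ?_
  have hσ' : 0 < σ := hσ
  have hh0 := hh.nonneg σ hσ
  have hn := pnat_cast_pos n
  by_cases hσr : σ < r
  · have hmem : σ ∈ Ioo 0 r := ⟨hσ', hσr⟩
    rw [indicator_of_mem hmem]
    have h2 : (n : ℝ) ^ (-2 * (K * σ)) * h σ ≤ h σ :=
      mul_le_of_le_one_left hh0 (rpow_le_one_of_pnat n (by nlinarith))
    have h3 : 0 ≤ (n : ℝ) ^ (r * (-2 * (K - 1))) * ((n : ℝ) ^ (-2 * σ) * h σ) := by positivity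
    linarith
  · rw [indicator_of_notMem fun hmem => hσr hmem.2, zero_add,
      ← mul_assoc ((n : ℝ) ^ (r * (-2 * (K - 1)))), ← Real.rpow_add hn]
    refine mul_le_mul_of_nonneg_right ?_ hh0
    refine Real.rpow_le_rpow_of_exponent_le (Nat.one_le_cast.2 n.pos) ?_
    nlinarith [not_lt.1 hσr]

/-- At the scale `l = 1 / log n` one has `w_h(n) ≥ e^{-2} mass(l)`, while `(κ)` makes `mass(ηl/2) ≤
2 G(ηl)` a small multiple of `G(l) ≤ mass(l)`. A large `K` handles `σ ≥ ηl/2`, where the gain is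
`exp(-η(K-1))`. -/
theorem Kappa.exists_integral_rpow_le (hh : IsDensity h) (hκ : Kappa (beta h)) {ε : ℝ}
    (hε : 0 < ε) : ∃ K : ℝ, 1 ≤ K ∧ ∀ᶠ n : ℕ+ in atTop,
      ∫ σ in Ioi (0 : ℝ), (n : ℝ) ^ (-2 * (K * σ)) * h σ ≤ ε * weight h n := by
  obtain ⟨η, hη, hev⟩ := hκ.exists_eventually_le hh
    (ε := ε / (4 * Real.exp 2)) (by positivity)
  have hexp : Tendsto (fun K : ℝ => Real.exp (η / 2 * (-2 * (K - 1)))) atTop (𝓝 0) := by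
    refine Real.tendsto_exp_atBot.comp ?_
    have : Tendsto (fun K : ℝ => η + (-η) * K) atTop atBot :=
      tendsto_atBot_add_const_left _ _ (tendsto_id.const_mul_atTop_of_neg (by linarith))
    exact this.congr fun K => by ring
  obtain ⟨K, hKε, hK⟩ := ((hexp.eventually (gt_mem_nhds (half_pos hε))).and
    (eventually_ge_atTop 1)).exists
  refine ⟨K, hK, ?_⟩
  have hinv : Tendsto (fun n : ℕ+ => (Real.log n)⁻¹) atTop (𝓝[>] 0) :=
    tendsto_inv_atTop_nhdsGT_zero.comp tendsto_log_pnat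
  filter_upwards [hinv.eventually hev, tendsto_log_pnat.eventually_gt_atTop 0] with n hn hlog
  set l : ℝ := (Real.log n)⁻¹ with hl
  have hl0 : 0 < l := inv_pos.2 hlog
  have hr : 0 < η * l / 2 := by positivity
  refine (hh.integral_rpow_le n hK hr).trans ?_
  have h1 := hh.mass_le_two_mul hr
  rw [mul_div_cancel₀ _ two_ne_zero] at h1
  have h2 := hh.beta_div_le_mass hl0
  have h3 : Real.exp (-2) * mass h l ≤ weight h n := by
    have := hh.rpow_mul_mass_le n hl0
    rwa [mul_comm (-2) l, rpow_inv_log_mul hlog] at this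
  have h4 : mass h l ≤ Real.exp 2 * weight h n := by
    rw [Real.exp_neg, inv_mul_le_iff₀ (Real.exp_pos 2)] at h3
    exact h3
  have h5 : (n : ℝ) ^ (η * l / 2 * (-2 * (K - 1))) ≤ ε / 2 := by
    rw [show η * l / 2 * (-2 * (K - 1)) = l * (η / 2 * (-2 * (K - 1))) by ring,
      rpow_inv_log_mul hlog]
    exact hKε.le
  have h6 : mass h (η * l / 2) ≤ ε / 2 * weight h n := by
    calc _ ≤ 2 * (ε / (4 * Real.exp 2) * (Real.exp 2 * weight h n)) := by
          refine h1.trans (mul_le_mul_of_nonneg_left (hn.trans ?_) two_pos.le)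
          exact mul_le_mul_of_nonneg_left (h2.trans h4) (by positivity)
      _ = _ := by
          field_simp
          ring
  nlinarith [mul_le_mul_of_nonneg_right h5 (hh.weight_pos n).le]

/-- The tail is at most `n^{-2δ}`, whereas the weight is at least `n^{-δ} mass(δ/2)`. -/
theorem IsDensity.eventually_integral_Ioi_le (hh : IsDensity h) {δ ε : ℝ} (hδ : 0 < δ)
    (hε : 0 < ε) : ∀ᶠ n : ℕ+ in atTop,
      ∫ σ in Ioi δ, (n : ℝ) ^ (-2 * σ) * h σ ≤ ε * weight h n := by
  have h1 : Tendsto (fun n : ℕ+ => (n : ℝ) ^ (-δ)) atTop (𝓝 0) :=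
    (tendsto_rpow_neg_atTop hδ).comp
      (tendsto_natCast_atTop_atTop.comp tendsto_PNat_val_atTop_atTop)
  have hm := hh.mass_pos (half_pos hδ)
  filter_upwards [h1.eventually (gt_mem_nhds (mul_pos hε hm))] with n hn
  have hsub : Ioi δ ⊆ Ioi (0 : ℝ) := Ioi_subset_Ioi hδ.le
  have hn0 := pnat_cast_pos n
  have h2 : ∫ σ in Ioi δ, (n : ℝ) ^ (-2 * σ) * h σ ≤ (n : ℝ) ^ (-2 * δ) := by
    calc _ ≤ ∫ σ in Ioi δ, (n : ℝ) ^ (-2 * δ) * h σ := by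
          refine setIntegral_mono_on ((hh.integrableOn_weight n).mono_set hsub)
            ((hh.integrable.mono_set hsub).const_mul _) measurableSet_Ioi fun σ hσ => ?_
          have hσ' : δ < σ := hσ
          refine mul_le_mul_of_nonneg_right ?_ (hh.nonneg σ (hδ.trans hσ))
          exact Real.rpow_le_rpow_of_exponent_le (Nat.one_le_cast.2 n.pos) (by linarith)
      _ = (n : ℝ) ^ (-2 * δ) * ∫ σ in Ioi δ, h σ := integral_const_mul _ _
      _ ≤ (n : ℝ) ^ (-2 * δ) * 1 := by
          gcongr
          rw [← hh.integral_eq_one]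
          refine setIntegral_mono_set hh.integrable ?_ hsub.eventuallyLE
          filter_upwards [ae_restrict_mem measurableSet_Ioi] with σ hσ
          exact hh.nonneg σ hσ
      _ = _ := mul_one _
  have h3 := hh.rpow_mul_mass_le n (half_pos hδ)
  rw [show -2 * (δ / 2) = -δ by ring] at h3
  have h4 : (n : ℝ) ^ (-2 * δ) = (n : ℝ) ^ (-δ) * (n : ℝ) ^ (-δ) := by
    rw [← Real.rpow_add hn0]
    congr 1
    ring
  have h5 : 0 < (n : ℝ) ^ (-δ) := Real.rpow_pos_of_pos hn0 _
  calc _ ≤ (n : ℝ) ^ (-δ) * (n : ℝ) ^ (-δ) := h4 ▸ h2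
    _ ≤ (ε * mass h (δ / 2)) * (n : ℝ) ^ (-δ) := by gcongr
    _ = ε * ((n : ℝ) ^ (-δ) * mass h (δ / 2)) := by ring
    _ ≤ _ := by gcongr

theorem IsDensity.norm_coeff_sq_mul_weight (hh : IsDensity h) (g : Bergman h) (n : ℕ+) :
    ‖coeff h g n‖ ^ 2 * weight h n = ‖g n‖ ^ 2 := by
  have := hh.weight_pos n
  rw [coeff, norm_div, div_pow, Complex.norm_real, Real.norm_of_nonneg (Real.sqrt_nonneg _),
    Real.sq_sqrt this.le, div_mul_cancel₀ _ this.ne']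

/-- The subordination principle integrated against `h`, with `μ = Kσ` for `σ ≤ δ` and `μ = σ`
beyond. -/
theorem sum_norm_sq_apply_le (hh : IsDensity h) {Φ : ℂ → ℂ} {T : Bergman h →L[ℂ] Bergman h}
    (hT : IsCompositionOperator h Φ T) (hext : DifferentiableOn ℂ Φ (halfPlane 0))
    (hre : ∀ s ∈ halfPlane 0, s.re ≤ (Φ s).re) {K δ : ℝ} (hK : 1 ≤ K) (hδ : 0 < δ)
    (hKδ : ∀ σ, 0 < σ → σ ≤ δ → ∀ s : ℂ, σ ≤ s.re → K * σ ≤ (Φ s).re)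
    {S : Finset ℕ+} {f : Bergman h} (hf : ∀ n ∉ S, f n = 0) (R : Finset ℕ+) :
    ∑ m ∈ R, ‖T f m‖ ^ 2 ≤ ∑ n ∈ S, ‖coeff h f n‖ ^ 2 *
      ((∫ σ in Ioi (0 : ℝ), (n : ℝ) ^ (-2 * (K * σ)) * h σ) +
        ∫ σ in Ioi δ, (n : ℝ) ^ (-2 * σ) * h σ) := by
  have heval : ∀ s : ℂ, 1 < s.re → LSeries (dirichletCoeff h (T f)) s =
      ∑ n ∈ S, coeff h f n * (n : ℂ) ^ (-Φ s) := by
    intro s hs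
    rw [← eval_eq_LSeries, hT f s (show 1 / 2 < s.re by linarith), eval, tsum_eq_sum]
    intro n hn
    rw [coeff, hf n hn, zero_div, zero_mul]
  have hsubord : ∀ {x μ : ℝ}, 0 < x → (∀ s : ℂ, x ≤ s.re → μ ≤ (Φ s).re) →
      ∑ m ∈ R, ‖coeff h (T f) m‖ ^ 2 * (m : ℝ) ^ (-2 * x) ≤
        ∑ n ∈ S, ‖coeff h f n‖ ^ 2 * (n : ℝ) ^ (-2 * μ) := by
    intro x μ hx hμ
    have := sum_norm_sq_le_of_subordinate hext hre S (coeff h f)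
      (fun s hs => hh.lseriesSummable_dirichletCoeff (T f) hs) heval hx hμ R
    simpa only [dirichletCoeff_coe] using this
  have hind : ∀ n : ℕ+, IntegrableOn
      ((Ioi δ).indicator fun σ => (n : ℝ) ^ (-2 * σ) * h σ) (Ioi 0) := fun n =>
    (hh.integrableOn_weight n).integrable.indicator measurableSet_Ioi
  have hindeq : ∀ n : ℕ+, ∫ σ in Ioi δ, (n : ℝ) ^ (-2 * σ) * h σ =
      ∫ σ in Ioi (0 : ℝ), (Ioi δ).indicator (fun σ => (n : ℝ) ^ (-2 * σ) * h σ) σ := fun n => by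
    rw [setIntegral_indicator measurableSet_Ioi,
      inter_eq_self_of_subset_right (Ioi_subset_Ioi hδ.le)]
  have hL : ∑ m ∈ R, ‖T f m‖ ^ 2 = ∫ σ in Ioi (0 : ℝ),
      ∑ m ∈ R, ‖coeff h (T f) m‖ ^ 2 * ((m : ℝ) ^ (-2 * σ) * h σ) := by
    rw [integral_finsetSum _ fun m _ => (hh.integrableOn_weight m).const_mul _]
    refine Finset.sum_congr rfl fun m _ => ?_
    rw [integral_const_mul, ← hh.norm_coeff_sq_mul_weight, weight]
  have hKint : ∀ n : ℕ+, IntegrableOn (fun σ => (n : ℝ) ^ (-2 * (K * σ)) * h σ) (Ioi 0) :=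
    fun n => hh.integrableOn_rpow_mul n (by linarith)
  have hadd : ∀ n : ℕ+, IntegrableOn (fun σ => (n : ℝ) ^ (-2 * (K * σ)) * h σ +
      (Ioi δ).indicator (fun σ => (n : ℝ) ^ (-2 * σ) * h σ) σ) (Ioi 0) :=
    fun n => (hKint n).add (hind n)
  have hR : ∑ n ∈ S, ‖coeff h f n‖ ^ 2 *
      ((∫ σ in Ioi (0 : ℝ), (n : ℝ) ^ (-2 * (K * σ)) * h σ) +
        ∫ σ in Ioi δ, (n : ℝ) ^ (-2 * σ) * h σ) = ∫ σ in Ioi (0 : ℝ),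
      ∑ n ∈ S, ‖coeff h f n‖ ^ 2 * ((n : ℝ) ^ (-2 * (K * σ)) * h σ +
        (Ioi δ).indicator (fun σ => (n : ℝ) ^ (-2 * σ) * h σ) σ) := by
    rw [integral_finsetSum _ fun n _ => (hadd n).const_mul _]
    refine Finset.sum_congr rfl fun n _ => ?_
    rw [integral_const_mul, integral_add (hKint n) (hind n), hindeq]
  rw [hL, hR]
  refine setIntegral_mono_on
    (integrable_finsetSum _ fun m _ => (hh.integrableOn_weight m).const_mul _)
    (integrable_finsetSum _ fun n _ => (hadd n).const_mul _)
    measurableSet_Ioi fun σ hσ => ?_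
  have hσ' : 0 < σ := hσ
  have hh0 := hh.nonneg σ hσ
  have hfac : ∑ m ∈ R, ‖coeff h (T f) m‖ ^ 2 * ((m : ℝ) ^ (-2 * σ) * h σ) =
      (∑ m ∈ R, ‖coeff h (T f) m‖ ^ 2 * (m : ℝ) ^ (-2 * σ)) * h σ := by
    rw [Finset.sum_mul]
    exact Finset.sum_congr rfl fun m _ => (mul_assoc _ _ _).symm
  rw [hfac]
  by_cases hσδ : σ ≤ δ
  · refine (mul_le_mul_of_nonneg_right (hsubord hσ' (hKδ σ hσ' hσδ)) hh0).trans (le_of_eq ?_)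
    rw [Finset.sum_mul]
    refine Finset.sum_congr rfl fun n _ => ?_
    rw [indicator_of_notMem (notMem_Ioi.2 hσδ), add_zero]
    ring
  · have hmem : σ ∈ Ioi δ := not_le.1 hσδ
    refine (mul_le_mul_of_nonneg_right (hsubord (μ := σ) hσ' fun s hs =>
      hs.trans (hre s (hσ'.trans_le hs))) hh0).trans ?_
    rw [Finset.sum_mul]
    refine Finset.sum_le_sum fun n _ => ?_
    rw [indicator_of_mem hmem, mul_assoc]
    have hn := pnat_cast_pos n
    have : 0 ≤ (n : ℝ) ^ (-2 * (K * σ)) * h σ := by positivity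
    gcongr
    linarith

theorem exists_mul_le_re {Φ : ℂ → ℂ} (hre : ∀ s ∈ halfPlane 0, s.re ≤ (Φ s).re)
    (hlim : Tendsto (fun s : ℂ => s.re / (Φ s).re) reToZero (𝓝 0)) {K : ℝ} (hK : 1 ≤ K) :
    ∃ δ : ℝ, 0 < δ ∧ ∀ σ, 0 < σ → σ ≤ δ → ∀ s : ℂ, σ ≤ s.re → K * σ ≤ (Φ s).re := by
  have hK0 : 0 < K := one_pos.trans_le hK
  obtain ⟨δ, hδ, H⟩ := eventually_reToZero (hlim.eventually (gt_mem_nhds (inv_pos.2 hK0)))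
  -- Dividing by `K` covers the points with `Re s ≥ δ`, where only `Re Φ(s) ≥ Re s ≥ δ ≥ Kσ` is
  -- available.
  refine ⟨δ / K, div_pos hδ hK0, fun σ hσ hσδ s hs => ?_⟩
  have hs0 : 0 < s.re := hσ.trans_le hs
  have h1 := hre s hs0
  rcases lt_or_ge s.re δ with h | h
  · have h2 := H s hs0 h
    rw [div_lt_iff₀ (hs0.trans_le h1), inv_mul_eq_div, lt_div_iff₀ hK0] at h2
    nlinarith
  · rw [le_div_iff₀ hK0] at hσδ
    linarith

/-- A bounded composition operator whose symbol satisfies `Re s / Re Φ(s) → 0` is small on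
functions with only high frequencies. -/
theorem eventually_norm_apply_le (hh : IsDensity h) (hκ : Kappa (beta h)) {Φ : ℂ → ℂ}
    {T : Bergman h →L[ℂ] Bergman h} (hT : IsCompositionOperator h Φ T)
    (hext : DifferentiableOn ℂ Φ (halfPlane 0)) (hre : ∀ s ∈ halfPlane 0, s.re ≤ (Φ s).re)
    (hlim : Tendsto (fun s : ℂ => s.re / (Φ s).re) reToZero (𝓝 0)) {ε : ℝ} (hε : 0 < ε) :
    ∀ᶠ N : ℕ+ in atTop, ∀ (f : Bergman h) (S : Finset ℕ+), (∀ n ∈ S, N ≤ n) →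
      (∀ n ∉ S, f n = 0) → ‖T f‖ ≤ ε * ‖f‖ := by
  have hε2 : 0 < ε ^ 2 / 2 := by positivity
  obtain ⟨K, hK, hev⟩ := hκ.exists_integral_rpow_le hh hε2
  obtain ⟨δ, hδ, hKδ⟩ := exists_mul_le_re hre hlim hK
  filter_upwards [eventually_forall_ge_atTop.2
    (hev.and (hh.eventually_integral_Ioi_le hδ hε2))] with
    N hN f S hNS hf
  have htwo : (2 : ℝ≥0∞).toReal = 2 := by simp
  refine lp.norm_le_of_forall_sum_le (by simp) (by positivity) fun R => ?_
  simp only [htwo, Real.rpow_two]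
  refine (sum_norm_sq_apply_le hh hT hext hre hK hδ hKδ hf R).trans ?_
  have hfS : ∑ n ∈ S, ‖f n‖ ^ 2 ≤ ‖f‖ ^ 2 := by
    have := lp.sum_rpow_le_norm_rpow (p := 2) (by simp) f S
    simpa only [htwo, Real.rpow_two] using this
  rw [mul_pow]
  refine le_trans ?_ (mul_le_mul_of_nonneg_left hfS (sq_nonneg ε))
  rw [Finset.mul_sum]
  refine Finset.sum_le_sum fun n hn => ?_
  obtain ⟨h1, h2⟩ := hN n (hNS n hn)
  rw [← hh.norm_coeff_sq_mul_weight]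
  calc _ ≤ ‖coeff h f n‖ ^ 2 * (ε ^ 2 / 2 * weight h n + ε ^ 2 / 2 * weight h n) := by gcongr
    _ = _ := by ring

/-- An operator on `ℓ²` that is small on vectors supported on high indices is compact. -/
theorem isCompactOperator_of_small_tails {E : Type*} [NormedAddCommGroup E] [NormedSpace ℂ E]
    [CompleteSpace E] (T : lp (fun _ : ℕ+ => ℂ) 2 →L[ℂ] E)
    (hT : ∀ ε > 0, ∀ᶠ N : ℕ+ in atTop, ∀ (f : lp (fun _ : ℕ+ => ℂ) 2) (S : Finset ℕ+),
      (∀ n ∈ S, N ≤ n) → (∀ n ∉ S, f n = 0) → ‖T f‖ ≤ ε * ‖f‖) : IsCompactOperator T := by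
  classical
  -- `T` restricted to the `n`-th coordinate: it factors through `ℂ`, so it is compact, and the
  -- partial sums approximate `T` in norm.
  set P : ℕ+ → lp (fun _ : ℕ+ => ℂ) 2 →L[ℂ] E := fun n =>
    (T.comp (lp.singleContinuousLinearMap ℂ (fun _ : ℕ+ => ℂ) 2 n)).comp
      (lp.evalCLM ℂ (fun _ : ℕ+ => ℂ) 2 n) with hP
  have hPapply : ∀ n f, P n f = T (lp.single 2 n (f n)) := fun n f => rfl
  have hPc : ∀ n, P n ∈ compactOperator (RingHom.id ℂ) (lp (fun _ : ℕ+ => ℂ) 2) E := fun n =>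
    (isCompactOperator_of_locallyCompactSpace_rng
      (T.comp (lp.singleContinuousLinearMap ℂ (fun _ : ℕ+ => ℂ) 2 n))).comp_clm _
  refine isCompactOperator_of_tendsto (l := atTop)
    (F := fun N : ℕ+ => ∑ n ∈ Finset.Iio N, P n) ?_
    (Eventually.of_forall fun N => Submodule.sum_mem _ fun n _ => hPc n)
  rw [Metric.tendsto_nhds]
  intro ε hε
  filter_upwards [hT (ε / 2) (half_pos hε)] with N hN
  rw [dist_comm, dist_eq_norm]
  refine lt_of_le_of_lt (ContinuousLinearMap.opNorm_le_bound _ (by positivity) fun g => ?_)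
    (half_lt_self hε)
  have hsum := (lp.hasSum_single (p := 2) (by simp) g).mapL T
  -- The tail hypothesis covers finitely supported vectors only; the general `g` is reached as a
  -- limit of its finite truncations.
  have hlim : Tendsto (fun S : Finset ℕ+ => ‖∑ n ∈ S, T (lp.single 2 n (g n)) -
      ∑ n ∈ Finset.Iio N, P n g‖) atTop (𝓝 ‖T g - ∑ n ∈ Finset.Iio N, P n g‖) :=
    (Tendsto.sub_const hsum _).norm
  rw [sub_apply, sum_apply]
  refine le_of_tendsto hlim ?_
  filter_upwards [eventually_ge_atTop (Finset.Iio N)] with S hS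
  simp only [hPapply]
  rw [← Finset.sum_sdiff hS, add_sub_cancel_right, ← map_sum]
  set f : lp (fun _ : ℕ+ => ℂ) 2 := ∑ n ∈ S \ Finset.Iio N, lp.single 2 n (g n) with hf
  have hfg : ‖f‖ ≤ ‖g‖ := by
    have h1 := lp.norm_sum_single (E := fun _ : ℕ+ => ℂ) (p := 2) (by simp) g (S \ Finset.Iio N)
    have h2 := lp.sum_rpow_le_norm_rpow (p := 2) (by simp) g (S \ Finset.Iio N)
    rw [← h1] at h2
    exact (Real.rpow_le_rpow_iff (norm_nonneg _) (norm_nonneg _) (by simp)).1 h2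
  have h3 := hN f (S \ Finset.Iio N) (fun n hn => by simpa using (Finset.mem_sdiff.1 hn).2)
    fun n hn => by
      rw [hf, lp.coeFn_sum, Finset.sum_apply]
      refine Finset.sum_eq_zero fun m hm => ?_
      exact lp.single_apply_ne _ _ _ fun hnm => hn (hnm ▸ hm)
  refine h3.trans ?_
  gcongr

end Compactness

end DirichletBergman

theorem mainTheorem10 (h : ℝ → ℝ) (hh : DirichletBergman.IsDensity h)
    (hκ : DirichletBergman.Kappa (DirichletBergman.beta h))
    (c₀ : ℕ) (hc₀ : 1 ≤ c₀) (Φ : ℂ → ℂ)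
    (hΦ : DirichletBergman.IsSymbol h c₀ Φ)
    (hext : DifferentiableOn ℂ Φ (DirichletBergman.halfPlane 0))
    (hlim : Tendsto (fun s : ℂ => s.re / (Φ s).re) DirichletBergman.reToZero (𝓝 0)) :
    ((∀ s ∈ DirichletBergman.halfPlane 0,
        DirichletBergman.nevanlinna (DirichletBergman.beta h) Φ s ≠ ⊤) ∧
      (fun s : ℂ => (DirichletBergman.nevanlinna (DirichletBergman.beta h) Φ s).toReal)
        =o[DirichletBergman.reToZero] (fun s : ℂ => DirichletBergman.beta h s.re)) ∧
    ((∃ A : ℝ, ∀ s ∈ DirichletBergman.halfPlane 0, |(Φ s - c₀ * s).im| ≤ A) →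
      DirichletBergman.CompositionCompact h Φ) := by
  obtain ⟨T, hT⟩ := hΦ.bounded
  have hc : (1 : ℝ) ≤ c₀ := by exact_mod_cast hc₀
  have hc0 : (0 : ℝ) < c₀ := one_pos.trans_le hc
  have hre : ∀ s ∈ DirichletBergman.halfPlane 0, 0 ≤ (Φ s).re := fun s hs =>
    hT.re_nonneg hh hext hs
  have hang : Tendsto (fun x : ℝ => Φ x / x) atTop (𝓝 ((c₀ : ℝ) : ℂ)) := by
    rw [Complex.ofReal_natCast]
    exact hΦ.inClassD.tendsto_div
  have hlittlewood : ∀ w : ℂ, 0 < w.re → ∀ S : Finset ℂ,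
      (∀ a ∈ S, a ∈ DirichletBergman.halfPlane 0 ∧ Φ a = w) → ∑ a ∈ S, a.re ≤ w.re / c₀ :=
    fun w hw S hS => DirichletBergman.sum_re_le_of_mapsTo hext hre hc0 hang hw S hS
  have hre' : ∀ s ∈ DirichletBergman.halfPlane 0, s.re ≤ (Φ s).re := fun s hs => by
    have hs0 : 0 < s.re := hs
    exact (le_mul_of_one_le_left hs0.le hc).trans
      (DirichletBergman.mul_re_le_re hext hre hc0 hang hs)
  refine ⟨⟨fun s hs => DirichletBergman.nevanlinna_ne_top hh hc hlittlewood hs,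
    DirichletBergman.nevanlinna_isLittleO hh hκ hc hlittlewood hlim⟩, fun _ => ⟨T, hT, ?_⟩⟩
  exact DirichletBergman.isCompactOperator_of_small_tails T fun ε hε =>
    DirichletBergman.eventually_norm_apply_le hh hκ hT hext hre' hlim hε
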